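/- **Setting.** Let $N,M\ge 0$, let $\mathcal F$ be the field of rational functions in $N+M$ independent variables with rational coefficients, and let $x_{N+1},\dots,x_{N+M}$ (the *stable variables*) be the last $M$ of them. Put $\mathbb A=\mathbb Z[x_{N+1},\dots,x_{N+M}]$ and $\bar{\mathbb A}=\mathbb Z[x_{N+1}^{\pm1},\dots,x_{N+M}^{\pm1}]$. A *seed* with multiplicities $d_1,\dots,d_N\ge1$ is a triple $\Sigma=(\mathbf x,\widetilde B,\mathcal P)$, where $\mathbf x=(x_1,\dots,x_N)$ is a transcendence basis of $\mathcal F$ over the field of fractions of $\bar{\mathbb A}$; $\widetilde B=(b_{ij})$ is an integer $N\times(N+M)$ matrix whose leading $N\times N$ submatrix is skew-symmetrizable, with $d_i\mid b_{ij}$ for $1\le i,j\le N$; and $\mathcal P$ consists of $N$ *strings* $(p_{ir})_{0\le r\le d_i}$ of monomials (with coefficient $1$) in $\mathbb A$ with $p_{i0}=p_{id_i}=1$. The $i$th string is *trivial* if $d_i=1$. The adjacent seed in direction $k\in\{1,\dots,N\}$ is obtained by replacing $x_k$ with $x_k'$, where $$x_kx_k'=\sum_{r=0}^{d_k}p_{kr}\,u_{k;>}^{r}\,v_{k;>}^{[r]}\,u_{k;<}^{d_k-r}\,v_{k;<}^{[d_k-r]},$$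 $$u_{k;>}=\prod_{i\le N,\,b_{ki}>0}x_i^{b_{ki}/d_k},\quad u_{k;<}=\prod_{i\le N,\,b_{ki}<0}x_i^{-b_{ki}/d_k},\quad v^{[r]}_{k;>}=\prod_{i>N,\,b_{ki}>0}x_i^{\lfloor rb_{ki}/d_k\rfloor},\quad v^{[r]}_{k;<}=\prod_{i>N,\,b_{ki}<0}x_i^{\lfloor -rb_{ki}/d_k\rfloor},$$ by replacing $\widetilde B$ with $\widetilde B'$, where $b'_{ij}=-b_{ij}$ if $i=k$ or $j=k$ and $b'_{ij}=b_{ij}+\tfrac12(|b_{ik}|b_{kj}+b_{ik}|b_{kj}|)$ otherwise, and by reversing the $k$th string, $p'_{kr}=p_{k,d_k-r}$, the other strings being unchanged. Seeds connected by a sequence of adjacent seeds are *mutation equivalent*. Let $\mathbb T_N$ be the $N$-regular tree whose edges are labeled by $1,\dots,N$ so that the edges at every vertex have different labels; a seed is attached to every vertex so that $\Sigma$ is attached to a chosen root and the seeds at the ends of an edge labeled $k$ are adjacent in direction $k$. A *nerve* $\mathcal N$ is a subtree of $\mathbb T_N$ on $N+1$ vertices all of whose edges have different labels. A stable variable $x_j$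 is *isolated* if $b_{ij}=0$ for $1\le i\le N$. For a nontrivial string, let $\widetilde B(i)$ be the integer matrix with $d_i-1$ rows whose $r$th row consists of the exponents of the isolated variables in $p_{ir}$, $1\le r\le d_i-1$. Let $S\subseteq\{N+1,\dots,N+M\}$ be an arbitrary subset and let the ground ring be $$\widehat{\mathbb A}=\mathbb Z\bigl[x_j^{\pm1}\ (j\in S),\ x_j\ (j\notin S)\bigr],\qquad \mathbb A\subseteq\widehat{\mathbb A}\subseteq\bar{\mathbb A}.$$ The *upper bound* $\overline{\mathcal A}(\mathcal N)$ is the intersection of the Laurent polynomial rings $\widehat{\mathbb A}[(x_1')^{\pm1},\dots,(x_N')^{\pm1}]\subset\mathcal F$ over the clusters $\mathbf x'=(x'_1,\dots,x'_N)$ of the seeds in $\mathcal N$; the *generalized upper cluster algebra* $\overline{\mathcal A}(\widetilde B,\mathcal P)$ over $\widehat{\mathbb A}$ is the intersection of these rings over the clusters of all seeds mutation equivalent to $\Sigma$. **Theorem.** Let $\widetilde B$ have full rank (that is, rank $N$), and let $\operatorname{rank}\widetilde B(i)=d_i-1$ for every nontrivial string in $\mathcal P$. Then the upper bounds $\overline{\mathcal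 A}(\mathcal N)$ do not depend on the choice of the nerve $\mathcal N$, and each of them coincides with the generalized upper cluster algebra $\overline{\mathcal A}(\widetilde B,\mathcal P)$ over $\widehat{\mathbb A}$. -/

import Mathlib

noncomputable section

namespace GenCluster

/-- The ambient field: rational functions with rational coefficients in `N + M` independent
variables. The last `M` of them (the summand `Fin M`) are the stable variables. -/
abbrev Ambient (N M : ℕ) : Type := FractionRing (MvPolynomial (Fin N ⊕ Fin M) ℚ)

/-- The stable variables. -/
def stableVar (N M : ℕ) (j : Fin M) : Ambient N M :=
  algebraMap (MvPolynomial (Fin N ⊕ Fin M) ℚ) (Ambient N M) (MvPolynomial.X (Sum.inr j))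

/-- The field of fractions (inside the ambient field) of the ring of Laurent polynomials in the
stable variables. -/
def stableField (N M : ℕ) : IntermediateField ℚ (Ambient N M) :=
  IntermediateField.adjoin ℚ (Set.range (stableVar N M))

/-- The ground ring obtained from the polynomial ring over `ℤ` in the stable variables by
inverting the stable variables with index in `S`. For `S = ∅` it is the ring of integer
polynomials, for `S = univ` the ring of integer Laurent polynomials in the stable variables. -/
def groundRing (N M : ℕ) (S : Set (Fin M)) : Subring (Ambient N M) :=
  Subring.closure (Set.range (stableVar N M) ∪ (fun j => (stableVar N M j)⁻¹) '' S)

/-- The data `(x, B̃, P)` of a seed with multiplicities `d`. The exchange coefficient `p_{ir}`,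
`0 ≤ r ≤ d i`, is a monomial in the stable variables, recorded by its exponents `coef i r`.
The conditions that such data have to satisfy are collected in `Seed.IsSeed`. -/
@[ext]
structure Seed (N M : ℕ) (d : Fin N → ℕ) where
  cluster : Fin N → Ambient N M
  B : Matrix (Fin N) (Fin N ⊕ Fin M) ℤ
  coef : (i : Fin N) → Fin (d i + 1) → Fin M → ℕ

namespace Seed

variable {N M : ℕ} {d : Fin N → ℕ}

/-- The principal part is skew-symmetrizable. -/
def IsSkewSymmetrizable (B : Matrix (Fin N) (Fin N ⊕ Fin M) ℤ) : Prop :=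
  ∃ D : Fin N → ℤ, (∀ i, 0 < D i) ∧
    ∀ i j, D i * B i (Sum.inl j) = -(D j * B j (Sum.inl i))

/-- The conditions on a seed: the cluster is a transcendence basis over the field of fractions of
the Laurent polynomials in stable variables, the principal part is skew-symmetrizable, `d i` is a
(positive) common divisor of the `i`th row of the principal part, and every string starts and ends
with `1`. -/
structure IsSeed (s : Seed N M d) : Prop where
  transcendence : IsTranscendenceBasis (stableField N M) s.cluster
  skew : IsSkewSymmetrizable s.B
  d_pos : ∀ i, 0 < d i
  d_dvd : ∀ i j, (d i : ℤ) ∣ s.B i (Sum.inl j)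
  coef_zero : ∀ i, s.coef i 0 = 0
  coef_last : ∀ i, s.coef i (Fin.last (d i)) = 0

/-- The exchange coefficient `p_{kr}` as an element of the ambient field. -/
def p (s : Seed N M d) (k : Fin N) (r : Fin (d k + 1)) : Ambient N M :=
  ∏ j, stableVar N M j ^ s.coef k r j

/-- The cluster `τ`-monomial `u_{k;>}`. -/
def uPos (s : Seed N M d) (k : Fin N) : Ambient N M :=
  ∏ i with 0 < s.B k (Sum.inl i), s.cluster i ^ (s.B k (Sum.inl i) / (d k : ℤ)).toNat

/-- The cluster `τ`-monomial `u_{k;<}`. -/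
def uNeg (s : Seed N M d) (k : Fin N) : Ambient N M :=
  ∏ i with s.B k (Sum.inl i) < 0, s.cluster i ^ (-s.B k (Sum.inl i) / (d k : ℤ)).toNat

/-- The stable `τ`-monomial `v_{k;>}^{[r]}`; integer division by `d k > 0` is the floor. -/
def vPos (s : Seed N M d) (k : Fin N) (r : ℕ) : Ambient N M :=
  ∏ j with 0 < s.B k (Sum.inr j),
    stableVar N M j ^ ((r : ℤ) * s.B k (Sum.inr j) / (d k : ℤ)).toNat

/-- The stable `τ`-monomial `v_{k;<}^{[r]}`; integer division by `d k > 0` is the floor. -/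
def vNeg (s : Seed N M d) (k : Fin N) (r : ℕ) : Ambient N M :=
  ∏ j with s.B k (Sum.inr j) < 0,
    stableVar N M j ^ (-((r : ℤ) * s.B k (Sum.inr j)) / (d k : ℤ)).toNat

/-- The generalized exchange polynomial (the right-hand side of the exchange relation). -/
def exchangePoly (s : Seed N M d) (k : Fin N) : Ambient N M :=
  ∑ r : Fin (d k + 1),
    s.p k r * s.uPos k ^ (r : ℕ) * s.vPos k (r : ℕ) *
      s.uNeg k ^ (d k - (r : ℕ)) * s.vNeg k (d k - (r : ℕ))

/-- Matrix mutation in direction `k`. -/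
def matrixMutation (B : Matrix (Fin N) (Fin N ⊕ Fin M) ℤ) (k : Fin N) :
    Matrix (Fin N) (Fin N ⊕ Fin M) ℤ :=
  Matrix.of fun i j =>
    if i = k ∨ j = Sum.inl k then -B i j
    else B i j + (|B i (Sum.inl k)| * B k j + B i (Sum.inl k) * |B k j|) / 2

/-- The adjacent seed in direction `k`: the variable `x_k` is replaced by
`x_k' = (exchange polynomial) / x_k`, and the `k`th string is reversed. -/
def mutate (s : Seed N M d) (k : Fin N) : Seed N M d where
  cluster := Function.update s.cluster k (s.exchangePoly k / s.cluster k)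
  B := matrixMutation s.B k
  coef := fun i r => if i = k then s.coef i r.rev else s.coef i r

/-- Mutation equivalence: `t` is reached from `s` by a sequence of pairwise adjacent seeds. -/
def MutationEquiv (s t : Seed N M d) : Prop :=
  Relation.ReflTransGen (fun s₁ s₂ : Seed N M d => ∃ k, s₂ = s₁.mutate k) s t

/-- The stable variable with index `j` is isolated: its column of the extended exchange matrix
vanishes. -/
abbrev IsIsolated (s : Seed N M d) (j : Fin M) : Prop := ∀ i, s.B i (Sum.inr j) = 0

/-- The `(d i - 1) × L` matrix `B̃(i)` of the `i`th string: its rows hold the exponents of the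
isolated variables in `p_{i1}, …, p_{i,d_i-1}`. -/
def stringMatrix (s : Seed N M d) (i : Fin N) :
    Matrix (Fin (d i - 1)) {j : Fin M // s.IsIsolated j} ℤ :=
  Matrix.of fun r j => (s.coef i ⟨(r : ℕ) + 1, by omega⟩ (j : Fin M) : ℤ)

/-- The ring of Laurent polynomials over the ground ring `A` in the variables of the cluster. -/
def laurentRing (A : Subring (Ambient N M)) (s : Seed N M d) : Subalgebra A (Ambient N M) :=
  Algebra.adjoin A (Set.range s.cluster ∪ Set.range fun i => (s.cluster i)⁻¹)

/-- The generalized upper cluster algebra over `A`. -/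
def upperClusterAlgebra (A : Subring (Ambient N M)) (s : Seed N M d) :
    Subalgebra A (Ambient N M) :=
  ⨅ t : {t : Seed N M d // s.MutationEquiv t}, laurentRing A t.1

end Seed

/-- Vertices of the `N`-regular tree: words in the labels without equal neighbouring letters. -/
abbrev TreeVertex (N : ℕ) : Type := {w : List (Fin N) // w.IsChain (· ≠ ·)}

/-- The vertices `v`, `w` are joined by an edge with label `k`. -/
def EdgeLabel {N : ℕ} (k : Fin N) (v w : TreeVertex N) : Prop :=
  w.1 = k :: v.1 ∨ v.1 = k :: w.1

/-- The labeled `N`-regular tree. -/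
def labeledTree (N : ℕ) : SimpleGraph (TreeVertex N) where
  Adj v w := ∃ k, EdgeLabel k v w
  symm := ⟨fun _ _ ⟨k, h⟩ => ⟨k, h.symm⟩⟩
  loopless := ⟨fun v ⟨k, h⟩ => by
    rcases h with h | h <;> simpa using congrArg List.length h⟩

/-- The seed at a vertex of the tree when `s` sits at the root: mutate along the word. -/
def seedAt {N M : ℕ} {d : Fin N → ℕ} (s : Seed N M d) (v : TreeVertex N) : Seed N M d :=
  v.1.foldr (fun k t => t.mutate k) s

/-- A nerve: a subtree on `N + 1` vertices whose edges have pairwise different labels. -/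
structure IsNerve {N : ℕ} (H : (labeledTree N).Subgraph) : Prop where
  isTree : H.coe.IsTree
  card : H.verts.ncard = N + 1
  labels : ∀ (k : Fin N) (v w v' w' : TreeVertex N), H.Adj v w → H.Adj v' w' →
    EdgeLabel k v w → EdgeLabel k v' w' → s(v, w) = s(v', w')

/-- The upper bound over `A` of a set of vertices of the tree with `s` at its root. -/
def upperBound {N M : ℕ} {d : Fin N → ℕ} (A : Subring (Ambient N M)) (s : Seed N M d)
    (H : (labeledTree N).Subgraph) : Subalgebra A (Ambient N M) :=
  ⨅ v : H.verts, Seed.laurentRing A (seedAt s v.1)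

end GenCluster

end

/-! Call `f` star-Laurent at a seed if it is a Laurent polynomial in its cluster and in all `N`
adjacent clusters. The theorem follows once this property is shown to pass to adjacent seeds. The
local statement is `mem_laurent_mutate_mutate`: if `f` is Laurent at `s`, `μ_k s` and `μ_j s`, it is
Laurent at `t = μ_j μ_k s`. Write `L` for the Laurent ring of `t`. Passing from `t` to a neighbour
only introduces the corresponding exchange polynomial as a denominator, so it suffices to find two
coprime denominators for `f` over `L`. One is always the `j`th exchange polynomial of `t`, because
`μ_k s` is adjacent to `t`.

If `b_jk = 0`, the mutations commute on clusters, so `μ_j s` also has the cluster of a neighbour of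
`t`, and the second denominator is the `k`th exchange polynomial. The two are relatively prime
(`isRelPrime_exPoly`), and this is where the rank conditions enter: a common factor is homogeneous
for enough gradings to divide a single monomial, while no variable divides an exchange polynomial.

If `b_jk ≠ 0`, all stable variables are inverted at first. Then `f` is a polynomial in `x_j`, `x_j'`
over Laurent polynomials in the other variables (`mem_closure_of_laurent`). Modulo `x_j` the `k`th
exchange polynomial `P_k` of `s` is a monomial, and the `j`th exchange polynomials of `s` and `μ_k
s` agree up to a monomial factor. Hence `x_j'` lies in `L[1/P_k]`, and `P_k` is comaximal with the
`j`th exchange polynomial. The noninverted stable variables are recovered because none of them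
divides an exchange polynomial (`mem_laurent_of_univ`).

Finally, along an edge of a nerve whose two ends carry `f`, being Laurent in direction `j` transfers
from end to end. Every direction occurs in the nerve, so `f` is star-Laurent at each vertex of the
nerve, hence at the root and at every mutation equivalent seed. -/

noncomputable section

namespace GenCluster

/-! ### Saturation of a subring -/

section Saturation

variable {K : Type*} [Field K]

/-- The elements that some power of `a` multiplies into the subring `L`. -/
def saturation (L : Subring K) (a : L) : Subring K where
  carrier := {f | ∃ n : ℕ, (a : K) ^ n * f ∈ L}
  mul_mem' := by
    rintro f g ⟨n, hn⟩ ⟨m, hm⟩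
    refine ⟨n + m, ?_⟩
    have := L.mul_mem hn hm
    convert this using 1
    ring
  one_mem' := ⟨0, by simp⟩
  add_mem' := by
    rintro f g ⟨n, hn⟩ ⟨m, hm⟩
    refine ⟨n + m, ?_⟩
    have h1 := L.mul_mem (L.pow_mem a.2 m) hn
    have h2 := L.mul_mem (L.pow_mem a.2 n) hm
    convert L.add_mem h1 h2 using 1
    ring
  zero_mem' := ⟨0, by simp⟩
  neg_mem' := by
    rintro f ⟨n, hn⟩
    exact ⟨n, by simpa using hn⟩

lemma le_saturation (L : Subring K) (a : L) : L ≤ saturation L a :=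
  fun f hf => ⟨0, by simpa using hf⟩

lemma mem_saturation_of_mul_mem {L : Subring K} {a : L} {f : K} (h : (a : K) * f ∈ L) :
    f ∈ saturation L a := ⟨1, by simpa using h⟩

/-- A divisor of `a` becomes a unit once `a` is inverted. -/
lemma inv_mem_saturation {L : Subring K} {a : L} {f g : K} (hg : g ∈ L) (h : f * g = a) :
    f⁻¹ ∈ saturation L a := by
  by_cases hf : f = 0
  · subst hf
    simp
  · refine mem_saturation_of_mul_mem ?_
    rw [← h, mul_comm f g, mul_assoc, mul_inv_cancel₀ hf, mul_one]
    exact hg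

/-- Powers of comaximal elements are comaximal, so `1 = u * a ^ n + v * b ^ m`; multiply by `f`. -/
lemma mem_of_mem_saturation_of_isCoprime {L : Subring K} {a b : L} (hab : IsCoprime a b) {f : K}
    (ha : f ∈ saturation L a) (hb : f ∈ saturation L b) : f ∈ L := by
  obtain ⟨n, hn⟩ := ha
  obtain ⟨m, hm⟩ := hb
  obtain ⟨u, v, huv⟩ := hab.pow (m := n) (n := m)
  have h := congrArg (Subtype.val) huv
  push_cast at h
  have : f = u * (a ^ n * f) + v * (b ^ m * f) := by
    linear_combination (-f) * h
  rw [this]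
  exact L.add_mem (L.mul_mem u.2 hn) (L.mul_mem v.2 hm)

/-- The counterpart for denominators that share no factor but need not be comaximal; unique
factorization, in the form of `DecompositionMonoid`, replaces the Bézout relation. -/
lemma mem_range_of_isRelPrime {D : Type*} [CommRing D] [IsDomain D] [DecompositionMonoid D]
    (e : D →+* K) (he : Function.Injective e) {p q : D} (hp : p ≠ 0) (hpq : IsRelPrime p q)
    {f : K} (hf : e p * f ∈ e.range) (hf' : e q * f ∈ e.range) : f ∈ e.range := by
  obtain ⟨g, hg⟩ := hf
  obtain ⟨h, hh⟩ := hf'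
  have hep : e p ≠ 0 := by
    intro h0
    exact hp (he (by simpa using h0))
  have h1 : q * g = p * h := he (by rw [map_mul, map_mul, hg, hh]; ring)
  obtain ⟨c, rfl⟩ := hpq.dvd_of_dvd_mul_left (Dvd.intro _ h1.symm)
  refine ⟨c, mul_left_cancel₀ hep ?_⟩
  rw [← hg, map_mul]

open Polynomial in
/-- If `y * y' = p` with `p` in the coefficient ring, an element that is a Laurent polynomial both
in `y` and in `y'` is a polynomial in `y` and `y'`. -/
lemma mem_closure_of_laurent {R : Subring K} {y y' : K} {p : R} (hp : p ≠ 0) (hyy : y * y' = p)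
    (hy : Transcendental R y) {f : K} {n m : ℕ} {F G : R[X]}
    (hF : y ^ n * f = aeval y F) (hG : y' ^ m * f = aeval y' G) :
    f ∈ Subring.closure ((R : Set K) ∪ {y, y'}) := by
  have hpK : (p : K) ≠ 0 := by simpa using hp
  have hy0 : y ≠ 0 := by rintro rfl; simp at hyy; exact hpK hyy.symm
  set d := G.natDegree with hd
  -- The two expansions of `f`, with `y' = p / y` substituted and denominators cleared.
  -- Transcendence of `y` makes this an identity of polynomials.
  have key : C (p ^ m) * F * X ^ d =
      X ^ (n + m) * ∑ i ∈ Finset.range (d + 1), C (G.coeff i * p ^ i) * X ^ (d - i) := by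
    refine transcendental_iff_injective.1 hy ?_
    have h1 : y ^ d * aeval y' G =
        ∑ i ∈ Finset.range (d + 1), (G.coeff i : K) * (p : K) ^ i * y ^ (d - i) := by
      rw [aeval_eq_sum_range, Finset.mul_sum]
      refine Finset.sum_congr rfl fun i hi => ?_
      have hi' : i ≤ d := by simpa [Nat.lt_succ_iff] using hi
      have : y ^ d = y ^ (d - i) * y ^ i := by rw [← pow_add]; congr 1; omega
      rw [this, ← hyy, mul_pow, Algebra.smul_def]
      change _ * ((G.coeff i : K) * _) = _
      ring
    have h2 : aeval y (∑ i ∈ Finset.range (d + 1), C (G.coeff i * p ^ i) * X ^ (d - i)) =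
        y ^ d * aeval y' G := by
      rw [h1, map_sum]
      refine Finset.sum_congr rfl fun i _ => ?_
      simp only [map_mul, map_pow, aeval_C, aeval_X]
      rfl
    rw [map_mul, map_mul, map_mul, h2, ← hG, ← hF]
    simp only [map_pow, aeval_C, aeval_X]
    change (p : K) ^ m * _ * _ = _
    rw [← hyy]
    ring
  -- Comparing coefficients at `X ^ (i + d)`: the coefficient of the negative power `y ^ (i - n)` in
  -- `f` is divisible by `p ^ (n - i)`, so that term is a multiple of `y' ^ (n - i)`.
  have hcoef : ∀ i < n, F.coeff i = G.coeff (n + m - i) * p ^ (n - i) := by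
    intro i hi
    have h := congrArg (fun q => q.coeff (i + d)) key
    simp only [coeff_mul_X_pow, coeff_C_mul] at h
    refine mul_left_cancel₀ (pow_ne_zero m hp) (h.trans ?_)
    rw [mul_comm (X ^ (n + m)), coeff_mul_X_pow']
    have hpow : p ^ m * (G.coeff (n + m - i) * p ^ (n - i)) =
        G.coeff (n + m - i) * p ^ (n + m - i) := by
      rw [show n + m - i = m + (n - i) by omega, pow_add]; ring
    rw [hpow]
    split_ifs with hle
    · rw [finsetSum_coeff, Finset.sum_eq_single (n + m - i)]
      · rw [coeff_C_mul, coeff_X_pow, if_pos (by omega), mul_one]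
      · intro b hb hne
        rw [coeff_C_mul, coeff_X_pow, if_neg, mul_zero]
        have := Finset.mem_range.1 hb
        omega
      · intro hb
        simp only [Finset.mem_range, not_lt] at hb
        omega
    · rw [coeff_eq_zero_of_natDegree_lt (by omega), zero_mul]
  have hf : f = ∑ i ∈ Finset.range (F.natDegree + 1), (y ^ n)⁻¹ * ((F.coeff i : K) * y ^ i) := by
    rw [← Finset.mul_sum]
    have : aeval y F = ∑ i ∈ Finset.range (F.natDegree + 1), (F.coeff i : K) * y ^ i := by
      rw [aeval_eq_sum_range]
      rfl
    rw [← this, ← hF, inv_mul_cancel_left₀ (pow_ne_zero n hy0)]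
  rw [hf]
  have hR : ∀ r : R, (r : K) ∈ Subring.closure ((R : Set K) ∪ {y, y'}) := fun r =>
    Subring.subset_closure (Or.inl r.2)
  have hy1 : y ∈ Subring.closure ((R : Set K) ∪ {y, y'}) :=
    Subring.subset_closure (Or.inr (by simp))
  have hy2 : y' ∈ Subring.closure ((R : Set K) ∪ {y, y'}) :=
    Subring.subset_closure (Or.inr (by simp))
  refine Subring.sum_mem _ fun i _ => ?_
  rcases lt_or_ge i n with hi | hi
  · have : (y ^ n)⁻¹ * ((F.coeff i : K) * y ^ i) = (G.coeff (n + m - i) : K) * y' ^ (n - i) := by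
      rw [hcoef i hi, Subring.coe_mul, Subring.coe_pow, ← hyy]
      have : y ^ n = y ^ (n - i) * y ^ i := by rw [← pow_add]; congr 1; omega
      rw [this, mul_pow]
      field_simp
    rw [this]
    exact Subring.mul_mem _ (hR _) (Subring.pow_mem _ hy2 _)
  · have : (y ^ n)⁻¹ * ((F.coeff i : K) * y ^ i) = (F.coeff i : K) * y ^ (i - n) := by
      have : y ^ i = y ^ (i - n) * y ^ n := by rw [← pow_add]; congr 1; omega
      rw [this]
      field_simp
    rw [this]
    exact Subring.mul_mem _ (hR _) (Subring.pow_mem _ hy1 _)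

end Saturation

namespace Seed

variable {N M : ℕ} {d : Fin N → ℕ}

/-! ### Exponents of the exchange polynomials -/

/-- The cluster variables together with the stable variables. -/
def vars (s : Seed N M d) : Fin N ⊕ Fin M → Ambient N M :=
  Sum.elim s.cluster (stableVar N M)

/-- The exponents of the `r`th monomial of the `k`th exchange polynomial. -/
def expo (s : Seed N M d) (k : Fin N) (r : Fin (d k + 1)) (i : Fin N ⊕ Fin M) : ℤ :=
  (r : ℤ) * s.B k i / d k + max (-s.B k i) 0 +
    Sum.elim (fun _ => 0) (fun j => (s.coef k r j : ℤ)) i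

/-- The exponents of the exchange polynomial, as a finitely supported function. -/
def expoFinsupp (s : Seed N M d) (k : Fin N) (r : Fin (d k + 1)) : Fin N ⊕ Fin M →₀ ℕ :=
  Finsupp.equivFunOnFinite.symm fun i => (s.expo k r i).toNat

/-- The exchange polynomial as a formal polynomial in cluster and stable variables. -/
def exPoly (s : Seed N M d) (k : Fin N) : MvPolynomial (Fin N ⊕ Fin M) ℤ :=
  ∑ r, MvPolynomial.monomial (s.expoFinsupp k r) 1

/-- Evaluation of formal polynomials at cluster and stable variables. -/
def ev (s : Seed N M d) : MvPolynomial (Fin N ⊕ Fin M) ℤ →+* Ambient N M :=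
  MvPolynomial.eval₂Hom (Int.castRingHom _) s.vars

@[simp] lemma ev_X (s : Seed N M d) (i : Fin N ⊕ Fin M) :
    s.ev (MvPolynomial.X i) = s.vars i := by
  simp [ev]

lemma ev_monomial (s : Seed N M d) (e : Fin N ⊕ Fin M →₀ ℕ) :
    s.ev (MvPolynomial.monomial e 1) = ∏ i, s.vars i ^ e i := by
  simp [ev, MvPolynomial.eval₂_monomial, Finsupp.prod_fintype]

/-- Adding a multiple of `n` commutes with the floor. This lets the single formula in `expo` cover
both signs of the matrix entry, for cluster and stable variables alike. -/
lemma mul_ediv_neg_aux {r n : ℕ} (hn : 0 < n) (hr : r ≤ n) (b : ℤ) :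
    -(((n - r : ℕ) : ℤ) * b) / n = r * b / n + -b := by
  have hn' : (n : ℤ) ≠ 0 := by omega
  rw [Nat.cast_sub hr, ← Int.add_mul_ediv_right _ _ hn']
  congr 1
  ring

lemma mul_ediv_add_nonneg {r n : ℕ} (hn : 0 < n) (hr : r ≤ n) (b : ℤ) :
    0 ≤ (r : ℤ) * b / n + max (-b) 0 := by
  rcases le_total 0 b with hb | hb
  · have : 0 ≤ (r : ℤ) * b / n := by positivity
    have : 0 ≤ max (-b) 0 := le_max_right _ _
    omega
  · rw [max_eq_left (by omega), ← mul_ediv_neg_aux hn hr]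
    have : 0 ≤ -(((n - r : ℕ) : ℤ) * b) := by
      have : ((n - r : ℕ) : ℤ) * b ≤ 0 := mul_nonpos_of_nonneg_of_nonpos (by positivity) hb
      omega
    positivity

lemma expo_nonneg (s : Seed N M d) (hd : ∀ i, 0 < d i) (k : Fin N) (r : Fin (d k + 1))
    (i : Fin N ⊕ Fin M) : 0 ≤ s.expo k r i := by
  have h1 := mul_ediv_add_nonneg (hd k) (Nat.lt_succ_iff.1 r.2) (s.B k i)
  have h2 : (0 : ℤ) ≤ Sum.elim (fun _ => 0) (fun j => (s.coef k r j : ℤ)) i := by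
    cases i <;> simp
  exact add_nonneg h1 h2

lemma cast_expoFinsupp (s : Seed N M d) (hd : ∀ i, 0 < d i) (k : Fin N) (r : Fin (d k + 1))
    (i : Fin N ⊕ Fin M) : (s.expoFinsupp k r i : ℤ) = s.expo k r i := by
  simp [expoFinsupp, Int.toNat_of_nonneg (s.expo_nonneg hd k r i)]

lemma ev_exPoly_eq_sum (s : Seed N M d) (k : Fin N) :
    s.ev (s.exPoly k) = ∑ r, ∏ i, s.vars i ^ s.expoFinsupp k r i := by
  simp [exPoly, map_sum, ev_monomial]

lemma exchangePoly_eq (s : Seed N M d) (hd : ∀ i, 0 < d i)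
    (hdvd : ∀ i j, (d i : ℤ) ∣ s.B i (Sum.inl j)) (k : Fin N) :
    s.exchangePoly k = s.ev (s.exPoly k) := by
  rw [ev_exPoly_eq_sum, exchangePoly]
  refine Finset.sum_congr rfl fun r _ => ?_
  have hr : (r : ℕ) ≤ d k := Nat.lt_succ_iff.1 r.2
  have hd' : (d k : ℤ) ≠ 0 := by have := hd k; omega
  rw [Fintype.prod_sum_type, p, uPos, uNeg, vPos, vNeg, ← Finset.prod_pow, ← Finset.prod_pow]
  simp only [Finset.prod_filter]
  have hL : (∏ i, s.vars (Sum.inl i) ^ s.expoFinsupp k r (Sum.inl i)) =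
      (∏ i, if 0 < s.B k (Sum.inl i) then
        (s.cluster i ^ (s.B k (Sum.inl i) / (d k : ℤ)).toNat) ^ (r : ℕ) else 1) *
      ∏ i, if s.B k (Sum.inl i) < 0 then
        (s.cluster i ^ (-s.B k (Sum.inl i) / (d k : ℤ)).toNat) ^ (d k - (r : ℕ)) else 1 := by
    rw [← Finset.prod_mul_distrib]
    refine Finset.prod_congr rfl fun i _ => ?_
    obtain ⟨c, hc⟩ := hdvd k i
    have e0 : (s.expoFinsupp k r (Sum.inl i) : ℤ) = r * c + max (-(d k * c)) 0 := by
      rw [cast_expoFinsupp _ hd, expo, hc, mul_left_comm, Int.mul_ediv_cancel_left _ hd']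
      simp
    have hdk : (0 : ℤ) < d k := by have := hd k; omega
    rw [hc, Int.mul_ediv_cancel_left _ hd', ← mul_neg, Int.mul_ediv_cancel_left _ hd']
    change s.cluster i ^ _ = _
    rcases lt_trichotomy c 0 with h | h | h
    · have h' : (d k : ℤ) * c < 0 := mul_neg_of_pos_of_neg hdk h
      rw [if_neg (by omega), if_pos (by omega), one_mul, ← pow_mul]
      congr 1
      zify [hr]
      rw [e0, max_eq_left (by omega), Int.toNat_of_nonneg (by omega)]
      ring
    · subst h
      simp at e0
      simp [e0]
    · have h' : 0 < (d k : ℤ) * c := mul_pos hdk h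
      rw [if_pos (by omega), if_neg (by omega), mul_one, ← pow_mul]
      congr 1
      zify
      rw [e0, max_eq_right (by omega), Int.toNat_of_nonneg (by omega)]
      ring
  have hR : (∏ j, s.vars (Sum.inr j) ^ s.expoFinsupp k r (Sum.inr j)) =
      (∏ j, stableVar N M j ^ s.coef k r j) *
      ((∏ j, if 0 < s.B k (Sum.inr j) then
        stableVar N M j ^ ((r : ℤ) * s.B k (Sum.inr j) / (d k : ℤ)).toNat else 1) *
      ∏ j, if s.B k (Sum.inr j) < 0 then
        stableVar N M j ^ (-(((d k - (r : ℕ) : ℕ) : ℤ) * s.B k (Sum.inr j)) / (d k : ℤ)).toNat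
        else 1) := by
    rw [← Finset.prod_mul_distrib, ← Finset.prod_mul_distrib]
    refine Finset.prod_congr rfl fun j _ => ?_
    have e0 : (s.expoFinsupp k r (Sum.inr j) : ℤ) = (r : ℤ) * s.B k (Sum.inr j) / d k +
        max (-s.B k (Sum.inr j)) 0 + s.coef k r j := by
      rw [cast_expoFinsupp _ hd, expo]
      simp
    have hnn := mul_ediv_add_nonneg (hd k) hr (s.B k (Sum.inr j))
    rw [mul_ediv_neg_aux (hd k) hr]
    change stableVar N M j ^ _ = _
    rcases lt_trichotomy (s.B k (Sum.inr j)) 0 with h | h | h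
    · rw [if_neg (by omega), if_pos (by omega), one_mul, ← pow_add]
      rw [max_eq_left (by omega)] at hnn e0
      congr 1
      zify
      rw [e0, Int.toNat_of_nonneg (by omega)]
      ring
    · rw [h] at e0
      simp at e0
      simp [h, e0]
    · rw [if_pos (by omega), if_neg (by omega), mul_one, ← pow_add]
      rw [max_eq_right (by omega)] at hnn e0
      congr 1
      zify
      rw [e0, Int.toNat_of_nonneg (by omega)]
      ring
  rw [hL, hR]
  ring

/-! ### Matrix mutation -/

lemma half_abs_mul (a b : ℤ) :
    (|a| * b + a * |b|) / 2 = if 0 ≤ a then a * max b 0 else a * max (-b) 0 := by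
  have : |a| * b + a * |b| = 2 * (if 0 ≤ a then a * max b 0 else a * max (-b) 0) := by
    split_ifs with ha
    · rw [abs_of_nonneg ha]
      rcases le_total 0 b with hb | hb
      · rw [abs_of_nonneg hb, max_eq_left hb]; ring
      · rw [abs_of_nonpos hb, max_eq_right hb]; ring
    · rw [abs_of_neg (by omega)]
      rcases le_total 0 b with hb | hb
      · rw [abs_of_nonneg hb, max_eq_right (by omega)]; ring
      · rw [abs_of_nonpos hb, max_eq_left (by omega)]; ring
  rw [this, Int.mul_ediv_cancel_left _ (by norm_num)]

lemma two_mul_half_abs_mul (a b : ℤ) :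
    2 * ((|a| * b + a * |b|) / 2) = |a| * b + a * |b| := by
  refine Int.mul_ediv_cancel' ?_
  rcases abs_choice a with ha | ha <;> rcases abs_choice b with hb | hb <;> rw [ha, hb]
  · exact ⟨a * b, by ring⟩
  · exact ⟨0, by ring⟩
  · exact ⟨0, by ring⟩
  · exact ⟨-(a * b), by ring⟩

lemma matrixMutation_self_row (B : Matrix (Fin N) (Fin N ⊕ Fin M) ℤ) (k : Fin N)
    (j : Fin N ⊕ Fin M) : matrixMutation B k k j = -B k j := by
  simp [matrixMutation]

lemma matrixMutation_self_col (B : Matrix (Fin N) (Fin N ⊕ Fin M) ℤ) (k i : Fin N) :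
    matrixMutation B k i (Sum.inl k) = -B i (Sum.inl k) := by
  simp [matrixMutation]

lemma matrixMutation_of_ne (B : Matrix (Fin N) (Fin N ⊕ Fin M) ℤ) {k i : Fin N}
    {j : Fin N ⊕ Fin M} (hi : i ≠ k) (hj : j ≠ Sum.inl k) : matrixMutation B k i j =
      B i j + (|B i (Sum.inl k)| * B k j + B i (Sum.inl k) * |B k j|) / 2 := by
  simp [matrixMutation, hi, hj]

lemma IsSkewSymmetrizable.diag {B : Matrix (Fin N) (Fin N ⊕ Fin M) ℤ}
    (h : IsSkewSymmetrizable B) (i : Fin N) : B i (Sum.inl i) = 0 := by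
  obtain ⟨D, hD, h⟩ := h
  have h1 := h i i
  have h2 := hD i
  have : D i * B i (Sum.inl i) = 0 := by linarith
  rcases mul_eq_zero.1 this with h | h
  · omega
  · exact h

lemma IsSkewSymmetrizable.pos_iff {B : Matrix (Fin N) (Fin N ⊕ Fin M) ℤ}
    (h : IsSkewSymmetrizable B) (i j : Fin N) : 0 < B i (Sum.inl j) ↔ B j (Sum.inl i) < 0 := by
  obtain ⟨D, hD, h⟩ := h
  have h1 := h i j
  constructor
  · intro hp
    have := mul_pos (hD i) hp
    by_contra hn
    have := mul_nonneg (hD j).le (not_lt.1 hn)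
    omega
  · intro hp
    have := mul_neg_of_pos_of_neg (hD j) hp
    by_contra hn
    have := mul_nonpos_of_nonneg_of_nonpos (hD i).le (not_lt.1 hn)
    omega

lemma IsSkewSymmetrizable.matrixMutation {B : Matrix (Fin N) (Fin N ⊕ Fin M) ℤ}
    (h : IsSkewSymmetrizable B) (k : Fin N) : IsSkewSymmetrizable (matrixMutation B k) := by
  obtain ⟨D, hD, h⟩ := h
  refine ⟨D, hD, fun i j => ?_⟩
  by_cases hi : i = k
  · subst hi
    rw [matrixMutation_self_row, matrixMutation_self_col]
    linarith [h i j]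
  by_cases hj : j = k
  · subst hj
    rw [matrixMutation_self_row, matrixMutation_self_col]
    linarith [h i j]
  rw [matrixMutation_of_ne _ hi (by simpa using hj), matrixMutation_of_ne _ hj (by simpa using hi)]
  have habs : ∀ {a b x y : ℤ}, 0 < a → 0 < b → a * x = -(b * y) → a * |x| = b * |y| := by
    intro a b x y ha hb hxy
    have := congrArg abs hxy
    rwa [abs_neg, abs_mul, abs_mul, abs_of_pos ha, abs_of_pos hb] at this
  have h1 := habs (hD i) (hD k) (h i k)
  have h2 := habs (hD j) (hD k) (h j k)
  have e1 := two_mul_half_abs_mul (B i (Sum.inl k)) (B k (Sum.inl j))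
  have e2 := two_mul_half_abs_mul (B j (Sum.inl k)) (B k (Sum.inl i))
  have h3 := h i j
  have h4 := h i k
  have h5 := h j k
  refine mul_left_cancel₀ (two_ne_zero (α := ℤ)) ?_
  linear_combination 2 * h3 + D i * e1 + D j * e2 + B k (Sum.inl j) * h1 +
    B k (Sum.inl i) * h2 + |B k (Sum.inl j)| * h4 + |B k (Sum.inl i)| * h5

lemma matrixMutation_matrixMutation (B : Matrix (Fin N) (Fin N ⊕ Fin M) ℤ) (k : Fin N) :
    matrixMutation (matrixMutation B k) k = B := by
  ext i j
  by_cases hi : i = k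
  · subst hi
    simp [matrixMutation_self_row]
  by_cases hj : j = Sum.inl k
  · subst hj
    simp [matrixMutation_self_col]
  rw [matrixMutation_of_ne _ hi hj, matrixMutation_of_ne _ hi hj, matrixMutation_self_row,
    matrixMutation_self_col]
  refine mul_left_cancel₀ (two_ne_zero (α := ℤ)) ?_
  have e1 := two_mul_half_abs_mul (B i (Sum.inl k)) (B k j)
  have e2 := two_mul_half_abs_mul (-B i (Sum.inl k)) (-B k j)
  rw [mul_add, mul_add, e1, e2, abs_neg, abs_neg]
  ring

lemma dvd_matrixMutation {B : Matrix (Fin N) (Fin N ⊕ Fin M) ℤ}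
    (h : ∀ i j, (d i : ℤ) ∣ B i (Sum.inl j)) (k i j : Fin N) :
    (d i : ℤ) ∣ matrixMutation B k i (Sum.inl j) := by
  by_cases hi : i = k
  · subst hi
    rw [matrixMutation_self_row]
    exact (h _ _).neg_right
  by_cases hj : j = k
  · subst hj
    rw [matrixMutation_self_col]
    exact (h _ _).neg_right
  rw [matrixMutation_of_ne _ hi (by simpa using hj), half_abs_mul]
  refine dvd_add (h _ _) ?_
  split_ifs <;> exact Dvd.dvd.mul_right (h _ _) _

lemma matrixMutation_rows {B : Matrix (Fin N) (Fin N ⊕ Fin M) ℤ} {k : Fin N}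
    (hkk : B k (Sum.inl k) = 0)
    (h : ∀ c : Fin N → ℚ, (∀ l, ∑ i, c i * (B i l : ℚ) = 0) → c = 0) (c : Fin N → ℚ)
    (hc : ∀ l, ∑ i, c i * (matrixMutation B k i l : ℚ) = 0) : c = 0 := by
  have hcol : ∑ i, c i * (B i (Sum.inl k) : ℚ) = 0 := by
    have := hc (Sum.inl k)
    simp only [matrixMutation_self_col, Int.cast_neg, mul_neg, Finset.sum_neg_distrib,
      neg_eq_zero] at this
    exact this
  set e : ℚ := ∑ i, c i * (|B i (Sum.inl k)| : ℤ) / 2 with he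
  -- Column `k` of the mutated matrix gives `∑ c_i b_ik = 0`, which removes all terms with `|b_kl|`.
  -- What is left is a relation among the old rows in which only the coefficient of row `k` has
  -- changed.
  have key : Function.update c k (e - c k) = 0 := by
    refine h _ fun l => ?_
    have hs : ∀ g : Fin N → ℚ, ∑ i, Function.update c k (e - c k) i * g i =
        ∑ i, c i * g i + (e - 2 * c k) * g k := by
      intro g
      rw [← Finset.add_sum_erase _ _ (Finset.mem_univ k),
        ← Finset.add_sum_erase (a := k) (f := fun i => c i * g i) _ (Finset.mem_univ k),
        Finset.sum_congr rfl (g := fun i => c i * g i)]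
      · simp only [Function.update_self]; ring
      · intro i hi
        rw [Function.update_of_ne (Finset.ne_of_mem_erase hi)]
    rw [hs]
    by_cases hl : l = Sum.inl k
    · subst hl
      rw [hcol, hkk]; simp
    · have h1 := hc l
      have h2 : ∀ i, c i * (matrixMutation B k i l : ℚ) = c i * (B i l : ℚ) +
          c i * (|B i (Sum.inl k)| : ℤ) / 2 * (B k l : ℚ) +
          c i * (B i (Sum.inl k) : ℚ) * ((|B k l| : ℤ) / 2) +
          (if i = k then -2 * c k * (B k l : ℚ) else 0) := by
        intro i
        split_ifs with hi
        · subst hi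
          rw [matrixMutation_self_row, hkk]
          push_cast
          simp
          ring
        · rw [matrixMutation_of_ne _ hi hl]
          have := congrArg (Int.cast : ℤ → ℚ)
            (two_mul_half_abs_mul (B i (Sum.inl k)) (B k l))
          push_cast at this ⊢
          linear_combination c i / 2 * this
      rw [Finset.sum_congr rfl fun i _ => h2 i, Finset.sum_add_distrib, Finset.sum_add_distrib,
        Finset.sum_add_distrib, ← Finset.sum_mul, ← Finset.sum_mul, hcol,
        Finset.sum_ite_eq' _ _ _, if_pos (Finset.mem_univ _)] at h1
      rw [← h1, ← he]
      ring
  have hne : ∀ i, i ≠ k → c i = 0 := fun i hi => by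
    have := congrFun key i
    rwa [Function.update_of_ne hi] at this
  have hk : c k = 0 := by
    have h1 := congrFun key k
    rw [Function.update_self] at h1
    have h2 : e = 0 := by
      rw [he]
      refine Finset.sum_eq_zero fun i _ => ?_
      by_cases hi : i = k
      · subst hi; simp [hkk]
      · simp [hne i hi]
    rw [h2] at h1
    simpa using h1
  funext i
  by_cases hi : i = k
  · subst hi; exact hk
  · exact hne i hi

/-! ### Nondegenerate seeds -/

/-- The conditions on seeds that are used below and preserved by mutations. Here `I` is a set of
indices of isolated variables. -/
structure Nondegenerate (I : Set (Fin M)) (s : Seed N M d) : Prop where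
  indep : AlgebraicIndependent ℚ s.vars
  skew : IsSkewSymmetrizable s.B
  d_pos : ∀ i, 0 < d i
  d_dvd : ∀ i j, (d i : ℤ) ∣ s.B i (Sum.inl j)
  coef_zero : ∀ i, s.coef i 0 = 0
  coef_last : ∀ i, s.coef i (Fin.last (d i)) = 0
  rows : ∀ c : Fin N → ℚ, (∀ l, ∑ i, c i * (s.B i l : ℚ) = 0) → c = 0
  isolated : ∀ j ∈ I, ∀ i, s.B i (Sum.inr j) = 0
  strings : ∀ i, ∀ c : Fin (d i + 1) → ℚ, c 0 = 0 → c (Fin.last (d i)) = 0 →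
    (∀ j ∈ I, ∑ r, c r * (s.coef i r j : ℚ) = 0) → c = 0

variable {I : Set (Fin M)} {s : Seed N M d}

lemma Nondegenerate.exchangePoly_eq (h : s.Nondegenerate I) (k : Fin N) :
    s.exchangePoly k = s.ev (s.exPoly k) :=
  s.exchangePoly_eq h.d_pos h.d_dvd k

lemma Nondegenerate.ev_injective (h : s.Nondegenerate I) : Function.Injective s.ev := by
  have : s.ev = (MvPolynomial.aeval s.vars).toRingHom.comp
      (MvPolynomial.map (σ := Fin N ⊕ Fin M) (Int.castRingHom ℚ)) := by
    ext <;> simp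
  rw [this]
  have h1 : Function.Injective (MvPolynomial.aeval (R := ℚ) s.vars) := h.indep
  exact h1.comp (MvPolynomial.map_injective _ Int.cast_injective)

lemma Nondegenerate.vars_ne_zero (h : s.Nondegenerate I) (i) : s.vars i ≠ 0 :=
  h.indep.ne_zero i

lemma Nondegenerate.expo_self (h : s.Nondegenerate I) (k : Fin N) (r) :
    s.expo k r (Sum.inl k) = 0 := by
  simp [expo, h.skew.diag]

lemma expo_zero (k : Fin N) (hc : s.coef k 0 = 0) (i) : s.expo k 0 i = max (-s.B k i) 0 := by
  cases i <;> simp [expo, hc]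

lemma expo_last (k : Fin N) (hd : 0 < d k) (hc : s.coef k (Fin.last _) = 0) (i) :
    s.expo k (Fin.last _) i = max (s.B k i) 0 := by
  have hd' : (d k : ℤ) ≠ 0 := by omega
  have : s.expo k (Fin.last _) i = s.B k i + max (-s.B k i) 0 := by
    cases i <;> simp [expo, hc, Int.mul_ediv_cancel_left _ hd']
  rw [this]
  rcases le_total 0 (s.B k i) with h | h
  · rw [max_eq_left h, max_eq_right (by omega)]; ring
  · rw [max_eq_right h, max_eq_left (by omega)]; ring

/-- An exchange polynomial does not vanish when a variable is set to zero. -/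
lemma Nondegenerate.not_X_dvd_exPoly (h : s.Nondegenerate I) (k : Fin N) (i) :
    ¬ MvPolynomial.X i ∣ s.exPoly k := by
  rintro ⟨g, hg⟩
  -- At `x_i = 0` and all other variables `1`, each monomial becomes `0` or `1`, so nothing cancels.
  -- The extreme monomials contain `x_i` with exponents `max (-b) 0` and `max b 0`, which are not
  -- both positive.
  have h1 := congrArg (MvPolynomial.eval (Function.update (fun _ => (1 : ℤ)) i 0)) hg
  have hmon : ∀ r, MvPolynomial.eval (Function.update (fun _ => (1 : ℤ)) i 0)
      (MvPolynomial.monomial (s.expoFinsupp k r) 1) = 0 ^ (s.expoFinsupp k r i) := by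
    intro r
    rw [MvPolynomial.eval_monomial, one_mul, Finsupp.prod_fintype _ _ (by simp),
      Finset.prod_eq_single i]
    · simp
    · intro j _ hj
      rw [Function.update_of_ne hj, one_pow]
    · simp
  rw [map_mul, MvPolynomial.eval_X, Function.update_self, zero_mul, exPoly, map_sum,
    Finset.sum_congr rfl fun r _ => hmon r] at h1
  have h2 := (Finset.sum_eq_zero_iff_of_nonneg (by intros; positivity)).1 h1
  have h3 := h2 0 (Finset.mem_univ _)
  have h4 := h2 (Fin.last _) (Finset.mem_univ _)
  have e3 : s.expoFinsupp k 0 i ≠ 0 := by intro h; simp [h] at h3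
  have e4 : s.expoFinsupp k (Fin.last _) i ≠ 0 := by intro h; simp [h] at h4
  have c3 := s.cast_expoFinsupp h.d_pos k 0 i
  have c4 := s.cast_expoFinsupp h.d_pos k (Fin.last _) i
  rw [expo_zero k (h.coef_zero k)] at c3
  rw [expo_last k (h.d_pos k) (h.coef_last k)] at c4
  omega

lemma Nondegenerate.exPoly_ne_zero (h : s.Nondegenerate I) (k : Fin N) : s.exPoly k ≠ 0 :=
  fun h0 => h.not_X_dvd_exPoly k (Sum.inl k) (h0 ▸ dvd_zero _)

lemma Nondegenerate.exchangePoly_ne_zero (h : s.Nondegenerate I) (k : Fin N) :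
    s.exchangePoly k ≠ 0 := by
  rw [h.exchangePoly_eq, Ne, map_eq_zero_iff _ h.ev_injective]
  exact h.exPoly_ne_zero k

end Seed

/-! ### Gradings of polynomial rings and divisors of homogeneous polynomials -/

section Grading

variable {σ : Type*}

/-- The weight of a monomial. -/
def weight [Fintype σ] (w : σ → ℚ) (e : σ →₀ ℕ) : ℚ := ∑ i, w i * e i

/-- The expansion of a polynomial into homogeneous components for the grading that gives the
variables the weights `w`. -/
def expand (w : σ → ℚ) :
    MvPolynomial σ ℤ →+* AddMonoidAlgebra (MvPolynomial σ ℤ) ℚ :=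
  MvPolynomial.eval₂Hom (Int.castRingHom _) fun i => AddMonoidAlgebra.single (w i) (MvPolynomial.X i)

lemma expand_monomial [Fintype σ] (w : σ → ℚ) (e : σ →₀ ℕ) :
    expand w (MvPolynomial.monomial e 1) =
      AddMonoidAlgebra.single (weight w e) (MvPolynomial.monomial e 1) := by
  classical
  have h : ∀ t : Finset σ, ∏ i ∈ t, AddMonoidAlgebra.single (w i) (MvPolynomial.X i) ^ e i =
      AddMonoidAlgebra.single (∑ i ∈ t, w i * e i)
        (∏ i ∈ t, (MvPolynomial.X i : MvPolynomial σ ℤ) ^ e i) := by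
    intro t
    induction t using Finset.induction_on with
    | empty => simp [AddMonoidAlgebra.one_def]
    | insert a t ha ih =>
      rw [Finset.prod_insert ha, ih, AddMonoidAlgebra.single_pow, AddMonoidAlgebra.single_mul_single,
        Finset.sum_insert ha, Finset.prod_insert ha]
      simp [mul_comm]
  rw [expand, MvPolynomial.coe_eval₂Hom, MvPolynomial.eval₂_monomial, map_one, one_mul,
    Finsupp.prod_fintype _ _ (by simp), h, MvPolynomial.monomial_eq, map_one, one_mul,
    Finsupp.prod_fintype _ _ (by simp)]
  rfl

/-- The sum of the homogeneous components. -/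
def collapse : AddMonoidAlgebra (MvPolynomial σ ℤ) ℚ →+* MvPolynomial σ ℤ :=
  (AddMonoidAlgebra.lift (MvPolynomial σ ℤ) (MvPolynomial σ ℤ) ℚ 1).toRingHom

lemma collapse_single (a : ℚ) (p : MvPolynomial σ ℤ) :
    collapse (AddMonoidAlgebra.single a p) = p := by
  simp [collapse]

lemma collapse_expand (w : σ → ℚ) (p : MvPolynomial σ ℤ) : collapse (expand w p) = p := by
  have : (collapse.comp (expand w)) = RingHom.id _ := by
    refine MvPolynomial.ringHom_ext (fun n => ?_) fun i => ?_
    · simp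
    · simp [expand, collapse_single]
  exact congrArg (fun f => f p) this

/-- Homogeneous polynomials for the weights `w`. -/
def IsWeighted (w : σ → ℚ) (p : MvPolynomial σ ℤ) : Prop :=
  ∃ a, expand w p = AddMonoidAlgebra.single a p

/-- If the supports had more than one pair of exponents, two different pairs would have a uniquely
represented sum (`TwoUniqueSums`). Both sums would survive in the product and so both equal `a`,
contradicting uniqueness. -/
lemma exists_eq_single_of_mul_eq_single {R : Type*} [CommRing R] [IsDomain R]
    {f g : AddMonoidAlgebra R ℚ} {a : ℚ} {c : R} (hc : c ≠ 0)
    (h : f * g = AddMonoidAlgebra.single a c) : ∃ b x, f = AddMonoidAlgebra.single b x := by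
  have hf : f ≠ 0 := by
    rintro rfl
    rw [zero_mul, eq_comm, AddMonoidAlgebra.single_eq_zero] at h
    exact hc h
  have hg : g ≠ 0 := by
    rintro rfl
    rw [mul_zero, eq_comm, AddMonoidAlgebra.single_eq_zero] at h
    exact hc h
  have hf' : 0 < f.coeff.support.card := by
    rw [Finset.card_pos, Finsupp.support_nonempty_iff]
    simpa using hf
  have hg' : 0 < g.coeff.support.card := by
    rw [Finset.card_pos, Finsupp.support_nonempty_iff]
    simpa using hg
  by_cases hcard : 1 < f.coeff.support.card * g.coeff.support.card
  · exfalso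
    obtain ⟨p, hp, q, hq, hne, hpu, hqu⟩ := TwoUniqueSums.uniqueAdd_of_one_lt_card hcard
    have key : ∀ p : ℚ × ℚ, p ∈ f.coeff.support ×ˢ g.coeff.support →
        UniqueAdd f.coeff.support g.coeff.support p.1 p.2 → p.1 + p.2 = a := by
      intro p hp hpu
      have h1 := AddMonoidAlgebra.coeff_mul_add_of_uniqueAdd hpu
      rw [Finset.mem_product, Finsupp.mem_support_iff, Finsupp.mem_support_iff] at hp
      by_contra hne
      rw [h, AddMonoidAlgebra.coeff_single, Finsupp.single_apply, if_neg (Ne.symm hne)] at h1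
      exact mul_ne_zero hp.1 hp.2 h1.symm
    have e := (key p hp hpu).trans (key q hq hqu).symm
    have := hpu (Finset.mem_product.1 hq).1 (Finset.mem_product.1 hq).2 e.symm
    exact hne (Prod.ext this.1.symm this.2.symm)
  · have h1 : f.coeff.support.card = 1 := by
      have := Nat.le_mul_of_pos_right f.coeff.support.card hg'
      omega
    obtain ⟨b, x, -, hx⟩ := Finsupp.card_support_eq_one'.1 h1
    refine ⟨b, x, ?_⟩
    ext y
    rw [hx, AddMonoidAlgebra.coeff_single]

variable {w : σ → ℚ} {q : MvPolynomial σ ℤ} {ι : Type*} {Q : ι → σ →₀ ℕ} {s : Finset ι}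

lemma sum_monomial_ne_zero (hs : s.Nonempty) :
    ∑ r ∈ s, MvPolynomial.monomial (Q r) (1 : ℤ) ≠ 0 := by
  intro h
  have := congrArg (MvPolynomial.eval fun _ => 1) h
  simp [MvPolynomial.eval_monomial, Finsupp.prod] at this
  exact hs.ne_empty this

lemma IsWeighted.of_dvd_sum [Fintype σ] (hs : s.Nonempty) {a : ℚ} (hw : ∀ r ∈ s, weight w (Q r) = a)
    (hq : q ∣ ∑ r ∈ s, MvPolynomial.monomial (Q r) 1) : IsWeighted w q := by
  obtain ⟨g, hg⟩ := hq
  have h : expand w q * expand w g =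
      AddMonoidAlgebra.single a (∑ r ∈ s, MvPolynomial.monomial (Q r) 1) := by
    rw [← map_mul, ← hg, map_sum, Finset.sum_congr rfl fun r hr => by
      rw [expand_monomial, hw r hr]]
    exact (map_sum (AddMonoidAlgebra.singleAddHom a) _ _).symm
  obtain ⟨b, x, hx⟩ := exists_eq_single_of_mul_eq_single (sum_monomial_ne_zero hs) h
  have := collapse_expand w q
  rw [hx, collapse_single] at this
  exact ⟨b, by rw [hx, this]⟩

lemma IsWeighted.dvd_component [Fintype σ] (hw : IsWeighted w q)
    (hq : q ∣ ∑ r ∈ s, MvPolynomial.monomial (Q r) 1) (a : ℚ) :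
    q ∣ ∑ r ∈ s with weight w (Q r) = a, MvPolynomial.monomial (Q r) 1 := by
  obtain ⟨g, hg⟩ := hq
  obtain ⟨b, hb⟩ := hw
  have h := congrArg (fun f => (expand w f).coeff a) hg
  simp only [map_mul, hb] at h
  have h1 : (expand w (∑ r ∈ s, MvPolynomial.monomial (Q r) 1)).coeff a =
      ∑ r ∈ s with weight w (Q r) = a, MvPolynomial.monomial (Q r) 1 := by
    rw [map_sum, AddMonoidAlgebra.coeff_sum, Finsupp.finsetSum_apply, Finset.sum_filter]
    refine Finset.sum_congr rfl fun r _ => ?_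
    rw [expand_monomial, AddMonoidAlgebra.coeff_single, Finsupp.single_apply]
  rw [← h1, h]
  refine ⟨(expand w g).coeff (-b + a), ?_⟩
  rw [AddMonoidAlgebra.coeff_single_mul_apply]

/-- The weight of a monomial under the weights given by a linear form. -/
lemma weight_eq_apply [Fintype σ] [DecidableEq σ] (f : (σ → ℚ) →ₗ[ℚ] ℚ) (e : σ →₀ ℕ) :
    weight (fun i => f (Pi.single i 1)) e = f fun i => (e i : ℚ) := by
  rw [weight, LinearMap.pi_apply_eq_sum_univ f]
  refine Finset.sum_congr rfl fun i _ => ?_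
  rw [smul_eq_mul, mul_comm]
  congr 2
  ext j
  simp [Pi.single_apply, eq_comm]

/-- A common divisor of two sums of monomials divides a monomial, if a weight is constant on the
exponents of the second sum and separates two exponents of the first one, and the exponents of
the first sum are affinely independent. -/
lemma dvd_monomial_of_dvd_sum [Fintype σ] [Fintype ι] {κ : Type*} [Fintype κ] [Nonempty κ]
    {Q' : κ → σ →₀ ℕ} {w₁ w₂ : σ → ℚ} {a b : ℚ} {i₀ i₁ : ι}
    (hq : q ∣ ∑ r, MvPolynomial.monomial (Q r) 1) (hq' : q ∣ ∑ r, MvPolynomial.monomial (Q' r) 1)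
    (h₁ : ∀ r, weight w₁ (Q' r) = a) (h₁' : weight w₁ (Q i₀) ≠ weight w₁ (Q i₁))
    (h₂ : ∀ r, r ≠ i₀ → weight w₂ (Q r) = b) (h₂' : weight w₂ (Q i₀) ≠ b) :
    q ∣ MvPolynomial.monomial (Q i₀) 1 := by
  classical
  have hw₁ : IsWeighted w₁ q := .of_dvd_sum Finset.univ_nonempty (fun r _ => h₁ r) hq'
  have hw₂ : IsWeighted w₂ q := by
    -- The `w₁`-component through `Q i₁` omits `Q i₀`, so `w₂` is constant on it; its divisor `q` is
    -- therefore `w₂`-homogeneous as well.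
    refine .of_dvd_sum (s := Finset.univ.filter fun r => weight w₁ (Q r) = weight w₁ (Q i₁))
      ⟨i₁, by simp⟩ (fun r hr => h₂ r ?_) (hw₁.dvd_component hq _)
    rintro rfl
    exact h₁' (Finset.mem_filter.1 hr).2
  have h := hw₂.dvd_component hq (weight w₂ (Q i₀))
  -- The exponent `Q i₀` is alone in its `w₂`-component.
  rwa [show Finset.univ.filter (fun r => weight w₂ (Q r) = weight w₂ (Q i₀)) = {i₀} from ?_,
    Finset.sum_singleton] at h
  ext r
  simp only [Finset.mem_filter, Finset.mem_univ, true_and, Finset.mem_singleton]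
  refine ⟨fun h => ?_, fun h => by rw [h]⟩
  by_contra hne
  exact h₂' (h ▸ h₂ r hne)

/-- A prime factor of `q` divides a product of variables, hence is associated to one of them. The
coefficient `1` rules out prime numbers. -/
lemma isUnit_of_dvd_monomial {e : σ →₀ ℕ} (hq : q ∣ MvPolynomial.monomial e 1)
    (hX : ∀ i, ¬ MvPolynomial.X i ∣ q) : IsUnit q := by
  by_contra hu
  have hq0 : q ≠ 0 := by
    rintro rfl
    rw [zero_dvd_iff, MvPolynomial.monomial_eq_zero] at hq
    exact one_ne_zero hq
  obtain ⟨p, hp, hpq⟩ := WfDvdMonoid.exists_irreducible_factor hu hq0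
  have hpp := UniqueFactorizationMonoid.irreducible_iff_prime.1 hp
  have h := hpq.trans hq
  rw [MvPolynomial.monomial_eq, map_one, one_mul, Finsupp.prod, hpp.dvd_finsetProd_iff] at h
  obtain ⟨i, -, hi⟩ := h
  have hass := hp.associated_of_dvd MvPolynomial.X_prime.irreducible (hpp.dvd_of_dvd_pow hi)
  exact hX i (hass.symm.dvd.trans hpq)

end Grading

/-! ### Exchange polynomials are coprime -/

namespace Seed

variable {N M : ℕ} {d : Fin N → ℕ} {I : Set (Fin M)} {s : Seed N M d}

/-- A row of the exchange matrix as a rational vector. -/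
def ratRow (s : Seed N M d) (k : Fin N) : Fin N ⊕ Fin M → ℚ := fun i => (s.B k i : ℚ)

/-- The difference of the exponents of the `r`th and the `0`th monomial of an exchange
polynomial. -/
def expoDiff (s : Seed N M d) (k : Fin N) (r : Fin (d k + 1)) : Fin N ⊕ Fin M → ℚ :=
  (fun i => (s.expoFinsupp k r i : ℚ)) - fun i => (s.expoFinsupp k 0 i : ℚ)

lemma Nondegenerate.expoDiff_apply (h : s.Nondegenerate I) (k : Fin N) (r) (i) :
    s.expoDiff k r i = ((s.expo k r i - s.expo k 0 i : ℤ) : ℚ) := by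
  rw [← s.cast_expoFinsupp h.d_pos, ← s.cast_expoFinsupp h.d_pos]
  simp [expoDiff]

lemma Nondegenerate.expoDiff_last (h : s.Nondegenerate I) (k : Fin N) :
    s.expoDiff k (Fin.last _) = s.ratRow k := by
  ext i
  rw [h.expoDiff_apply, expo_zero k (h.coef_zero k), expo_last k (h.d_pos k) (h.coef_last k),
    ratRow]
  congr 1
  omega

lemma Nondegenerate.expoDiff_isolated (h : s.Nondegenerate I) (k : Fin N) (r) {j} (hj : j ∈ I) :
    s.expoDiff k r (Sum.inr j) = s.coef k r j := by
  rw [h.expoDiff_apply]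
  simp [expo, h.isolated j hj, h.coef_zero]

lemma Nondegenerate.ratRow_isolated (h : s.Nondegenerate I) (k : Fin N) {j} (hj : j ∈ I) :
    s.ratRow k (Sum.inr j) = 0 := by
  simp [ratRow, h.isolated j hj]

lemma Nondegenerate.linearIndependent_ratRow (h : s.Nondegenerate I) :
    LinearIndependent ℚ s.ratRow := by
  rw [Fintype.linearIndependent_iff]
  intro c hc i
  refine congrFun (h.rows c fun l => ?_) i
  have := congrFun hc l
  simpa [ratRow] using this

/-- If a combination of the exponent differences vanishes on isolated variables, then only the
last one contributes. -/
lemma Nondegenerate.coeff_eq_zero (h : s.Nondegenerate I) (k : Fin N) (c : Fin (d k + 1) → ℚ)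
    (hc : ∀ j ∈ I, (∑ r, c r • s.expoDiff k r) (Sum.inr j) = 0) {r} (hr0 : r ≠ 0)
    (hr : r ≠ Fin.last _) : c r = 0 := by
  classical
  have h0 : (0 : Fin (d k + 1)) ≠ Fin.last _ := by
    have := h.d_pos k
    rw [Ne, Fin.ext_iff]
    simp
    omega
  have key := h.strings k (Function.update (Function.update c 0 0) (Fin.last _) 0)
    (by rw [Function.update_of_ne h0, Function.update_self]) (by rw [Function.update_self]) ?_
  · have := congrFun key r
    rwa [Function.update_of_ne hr, Function.update_of_ne hr0] at this
  · intro j hj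
    rw [← hc j hj, Finset.sum_apply]
    refine Finset.sum_congr rfl fun r _ => ?_
    rw [Pi.smul_apply, h.expoDiff_isolated k r hj, smul_eq_mul]
    by_cases hr : r = Fin.last _
    · subst hr
      simp [h.coef_last]
    by_cases hr0 : r = 0
    · subst hr0
      simp [h.coef_zero]
    rw [Function.update_of_ne hr, Function.update_of_ne hr0]

lemma expoDiff_zero (k : Fin N) : s.expoDiff k 0 = 0 := by simp [expoDiff]

lemma Nondegenerate.sum_smul_expoDiff (h : s.Nondegenerate I) (k : Fin N)
    (c : Fin (d k + 1) → ℚ)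
    (hc : ∀ j ∈ I, (∑ r, c r • s.expoDiff k r) (Sum.inr j) = 0) :
    ∑ r, c r • s.expoDiff k r = c (Fin.last _) • s.ratRow k := by
  rw [← h.expoDiff_last]
  refine Finset.sum_eq_single _ (fun r _ hr => ?_) (by simp)
  by_cases hr0 : r = 0
  · rw [hr0, expoDiff_zero, smul_zero]
  · rw [h.coeff_eq_zero k c hc hr0 hr, zero_smul]

/-- Row `k` vanishes on isolated variables, so in a combination of the exponent differences of `P_j`
only the last one, row `j`, can contribute. Distinct rows are not proportional. -/
lemma Nondegenerate.ratRow_notMem_span (h : s.Nondegenerate I) {j k : Fin N} (hjk : j ≠ k) :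
    s.ratRow k ∉ Submodule.span ℚ (Set.range (s.expoDiff j)) := by
  intro hmem
  obtain ⟨c, hc⟩ := (Submodule.mem_span_range_iff_exists_fun ℚ).1 hmem
  have h1 := h.sum_smul_expoDiff j c fun i hi => by rw [hc, h.ratRow_isolated k hi]
  rw [hc] at h1
  refine h.linearIndependent_ratRow.notMem_span_image (s := {j}) (x := k) (by simpa using hjk.symm) ?_
  rw [h1, Set.image_singleton]
  exact Submodule.smul_mem _ _ (Submodule.mem_span_singleton_self _)

/-- The isolated coordinates kill the inner coefficients, and the remaining vector is the nonzero
row `k`. -/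
lemma Nondegenerate.linearIndependent_expoDiff (h : s.Nondegenerate I) (k : Fin N) :
    LinearIndependent ℚ fun r : {r : Fin (d k + 1) // r ≠ 0} => s.expoDiff k r := by
  classical
  rw [Fintype.linearIndependent_iff]
  intro g hg
  set c : Fin (d k + 1) → ℚ := fun r => if hr : r ≠ 0 then g ⟨r, hr⟩ else 0 with hcdef
  have hsum : ∑ r, c r • s.expoDiff k r = 0 := by
    have h1 : ∑ r with r ≠ 0, c r • s.expoDiff k r = ∑ r, c r • s.expoDiff k r :=
      Finset.sum_filter_of_ne fun r _ hr hr0 => hr (by rw [hr0, expoDiff_zero, smul_zero])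
    rw [← hg, ← h1, Finset.sum_subtype (p := fun r => r ≠ 0) _ (by simp)]
    refine Finset.sum_congr rfl fun r _ => ?_
    simp [hcdef, r.2]
  have h1 := h.sum_smul_expoDiff k c fun i hi => by rw [hsum]; rfl
  rw [hsum] at h1
  have hlast : c (Fin.last _) = 0 := by
    rcases smul_eq_zero.1 h1.symm with h2 | h2
    · exact h2
    · exact absurd h2 (h.linearIndependent_ratRow.ne_zero k)
  intro r
  have hr : c r = g r := by simp [hcdef, r.2]
  rw [← hr]
  by_cases hrl : (r : Fin (d k + 1)) = Fin.last _
  · rw [hrl, hlast]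
  · exact h.coeff_eq_zero k c (fun i hi => by rw [hsum]; rfl) r.2 hrl

/-- Two gradings are used: `f` is constant on the exponents of `P_j` and separates the two ends of
`P_k`; `g` is constant on all exponents of `P_k` but the `0`th, which exists by affine independence.
They reduce a common divisor to a divisor of the `0`th monomial of `P_k`. -/
lemma Nondegenerate.isRelPrime_exPoly (h : s.Nondegenerate I) {j k : Fin N} (hjk : j ≠ k) :
    IsRelPrime (s.exPoly k) (s.exPoly j) := by
  classical
  intro q hq hq'
  obtain ⟨f, hf, hf'⟩ := Submodule.exists_le_ker_of_notMem (h.ratRow_notMem_span hjk)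
  have hli := h.linearIndependent_expoDiff k
  obtain ⟨g, hg⟩ := LinearMap.exists_extend
    ((Module.Basis.span hli).constr ℚ (fun _ => (1 : ℚ)))
  have hg1 : ∀ r, r ≠ 0 → g (s.expoDiff k r) = 1 := by
    intro r hr
    have h1 := LinearMap.congr_fun hg (Module.Basis.span hli ⟨r, hr⟩)
    rw [Module.Basis.constr_basis] at h1
    rw [← h1, LinearMap.comp_apply, Submodule.subtype_apply, Module.Basis.span_apply]
  have hX : ∀ i, ¬ MvPolynomial.X i ∣ q := fun i hi => h.not_X_dvd_exPoly k i (hi.trans hq)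
  refine isUnit_of_dvd_monomial (dvd_monomial_of_dvd_sum (i₀ := 0) (i₁ := Fin.last _)
    (w₁ := fun i => f (Pi.single i 1)) (w₂ := fun i => g (Pi.single i 1))
    (a := f fun i => (s.expoFinsupp j 0 i : ℚ)) (b := (g fun i => (s.expoFinsupp k 0 i : ℚ)) + 1)
    hq hq' (fun r => ?_) ?_ (fun r hr => ?_) ?_) hX
  · have h1 : f (s.expoDiff j r) = 0 := hf' (Submodule.subset_span ⟨r, rfl⟩)
    rw [expoDiff, map_sub, sub_eq_zero] at h1
    rw [weight_eq_apply, h1]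
  · rw [weight_eq_apply, weight_eq_apply]
    rw [← h.expoDiff_last, expoDiff, map_sub, sub_ne_zero] at hf
    exact hf.symm
  · have h1 := hg1 r hr
    rw [expoDiff, map_sub] at h1
    rw [weight_eq_apply]
    linarith
  · rw [weight_eq_apply]
    simp

end Seed

/-- Replacing one element of an algebraically independent family by an exchange. -/
lemma algebraicIndependent_update_div {ι F K : Type*} [Field F] [Field K] [Algebra F K]
    [DecidableEq ι] {z : ι → K} (hz : AlgebraicIndependent F z) (i : ι) {P : K} (hP0 : P ≠ 0)
    (hP : P ∈ Algebra.adjoin F (z '' {i}ᶜ)) :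
    AlgebraicIndependent F (Function.update z i (P / z i)) := by
  have himg : Function.update z i (P / z i) '' {i}ᶜ = z '' {i}ᶜ :=
    Set.image_congr fun j hj => Function.update_of_ne hj _ _
  rw [AlgebraicIndependent.iff_transcendental_adjoin_image i] at hz ⊢
  rw [himg, Function.update_self]
  refine ⟨?_, fun halg => hz.2 ?_⟩
  · convert hz.1 using 2 with j
    exact Function.update_of_ne j.2 _ _
  · have h1 : IsAlgebraic (Algebra.adjoin F (z '' {i}ᶜ)) P :=
      isAlgebraic_algebraMap (⟨P, hP⟩ : Algebra.adjoin F (z '' {i}ᶜ))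
    have h2 := h1.mul halg.inv
    rwa [inv_div, mul_div_cancel₀ _ hP0] at h2

/-! ### Mutation preserves nondegeneracy and is an involution -/

namespace Seed

variable {N M : ℕ} {d : Fin N → ℕ} {I : Set (Fin M)} {s : Seed N M d}

lemma vars_mutate (s : Seed N M d) (k : Fin N) : (s.mutate k).vars =
    Function.update s.vars (Sum.inl k) (s.exchangePoly k / s.cluster k) := by
  ext i
  rcases i with i | j
  · by_cases hi : i = k
    · subst hi; simp [vars, mutate]
    · simp [vars, mutate, hi]
  · simp [vars]

lemma vars_mutate_of_ne (s : Seed N M d) {k : Fin N} {i} (hi : i ≠ Sum.inl k) :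
    (s.mutate k).vars i = s.vars i := by
  rw [vars_mutate, Function.update_of_ne hi]

lemma vars_mutate_self (s : Seed N M d) (k : Fin N) :
    (s.mutate k).vars (Sum.inl k) = s.exchangePoly k / s.vars (Sum.inl k) := by
  rw [vars_mutate, Function.update_self]; rfl

lemma Nondegenerate.expoFinsupp_self (h : s.Nondegenerate I) (k : Fin N) (r) :
    s.expoFinsupp k r (Sum.inl k) = 0 := by
  have := s.cast_expoFinsupp h.d_pos k r (Sum.inl k)
  rw [h.expo_self] at this
  exact_mod_cast this

lemma Nondegenerate.exchangePoly_mem_adjoin (h : s.Nondegenerate I) (k : Fin N) :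
    s.exchangePoly k ∈ Algebra.adjoin ℚ (s.vars '' {Sum.inl k}ᶜ) := by
  rw [h.exchangePoly_eq, ev_exPoly_eq_sum]
  refine Subalgebra.sum_mem _ fun r _ => Subalgebra.prod_mem _ fun i _ => ?_
  by_cases hi : i = Sum.inl k
  · rw [hi, h.expoFinsupp_self, pow_zero]
    exact Subalgebra.one_mem _
  · exact Subalgebra.pow_mem _ (Algebra.subset_adjoin (Set.mem_image_of_mem _ hi)) _

lemma mutate_B (s : Seed N M d) (k : Fin N) : (s.mutate k).B = matrixMutation s.B k := rfl

lemma mutate_coef_self (s : Seed N M d) (k : Fin N) (r) :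
    (s.mutate k).coef k r = s.coef k r.rev := by
  simp [mutate]

lemma mutate_coef_of_ne (s : Seed N M d) {i k : Fin N} (hi : i ≠ k) :
    (s.mutate k).coef i = s.coef i := by
  ext r
  simp [mutate, hi]

/-- Columns with index in the fixed set `I` stay zero, and strings are at most reversed, so the rank
condition on strings can be stated with the same `I` for all mutated seeds. -/
lemma Nondegenerate.mutate (h : s.Nondegenerate I) (k : Fin N) :
    (s.mutate k).Nondegenerate I where
  indep := by
    rw [vars_mutate]
    exact algebraicIndependent_update_div h.indep _ (h.exchangePoly_ne_zero k)
      (h.exchangePoly_mem_adjoin k)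
  skew := h.skew.matrixMutation k
  d_pos := h.d_pos
  d_dvd := dvd_matrixMutation h.d_dvd k
  coef_zero i := by
    by_cases hi : i = k
    · subst hi
      rw [mutate_coef_self, Fin.rev_zero, h.coef_last]
    · rw [mutate_coef_of_ne _ hi, h.coef_zero]
  coef_last i := by
    by_cases hi : i = k
    · subst hi
      rw [mutate_coef_self, Fin.rev_last, h.coef_zero]
    · rw [mutate_coef_of_ne _ hi, h.coef_last]
  rows := matrixMutation_rows (h.skew.diag k) h.rows
  isolated j hj i := by
    rw [mutate_B]
    by_cases hi : i = k
    · subst hi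
      rw [matrixMutation_self_row, h.isolated j hj, neg_zero]
    · rw [matrixMutation_of_ne _ hi (by simp), h.isolated j hj, h.isolated j hj]
      simp
  strings i c h0 hl hc := by
    by_cases hi : i = k
    · subst hi
      have key := h.strings i (fun r => c r.rev) (by simpa using hl) (by simpa using h0) ?_
      · funext r
        have := congrFun key r.rev
        simpa using this
      · intro j hj
        rw [← hc j hj, ← Equiv.sum_comp Fin.revPerm]
        simp [mutate_coef_self]
    · refine h.strings i c h0 hl ?_
      rwa [mutate_coef_of_ne _ hi] at hc

/-- Reversing the string compensates for the change of sign of row `k`, since `(d - r) b / d = r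
(-b) / d + b` holds also for floors. -/
lemma Nondegenerate.expo_mutate_self (h : s.Nondegenerate I) (k : Fin N) (r) (i) :
    (s.mutate k).expo k r i = s.expo k r.rev i := by
  have h3 : (r.rev : ℤ) * s.B k i / d k = r * -s.B k i / d k + s.B k i := by
    have hd' : (d k : ℤ) ≠ 0 := by have := h.d_pos k; omega
    have : (r.rev : ℤ) * s.B k i = r * -s.B k i + s.B k i * d k := by
      have : ((r.rev : ℕ) : ℤ) = d k - r := by
        rw [Fin.val_rev]; omega
      rw [this]; ring
    rw [this, Int.add_mul_ediv_right _ _ hd']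
  have h4 : max (s.B k i) 0 = max (-s.B k i) 0 + s.B k i := by omega
  simp only [expo, mutate_coef_self, mutate_B, matrixMutation_self_row, neg_neg]
  rw [h3, h4]
  ring

lemma Nondegenerate.exchangePoly_mutate_self (h : s.Nondegenerate I) (k : Fin N) :
    (s.mutate k).exchangePoly k = s.exchangePoly k := by
  rw [(h.mutate k).exchangePoly_eq, h.exchangePoly_eq, ev_exPoly_eq_sum, ev_exPoly_eq_sum,
    ← Equiv.sum_comp Fin.revPerm]
  refine Finset.sum_congr rfl fun r _ => Finset.prod_congr rfl fun i _ => ?_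
  have : (s.mutate k).expoFinsupp k (Fin.revPerm r) i = s.expoFinsupp k r i := by
    zify
    rw [cast_expoFinsupp _ h.d_pos, cast_expoFinsupp _ h.d_pos, h.expo_mutate_self]
    simp
  rw [this]
  by_cases hi : i = Sum.inl k
  · rw [hi, h.expoFinsupp_self, pow_zero, pow_zero]
  · rw [vars_mutate_of_ne _ hi]

lemma Nondegenerate.mutate_mutate (h : s.Nondegenerate I) (k : Fin N) :
    (s.mutate k).mutate k = s := by
  refine Seed.ext ?_ (matrixMutation_matrixMutation _ _) ?_
  · funext i
    change Function.update (s.mutate k).cluster k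
      ((s.mutate k).exchangePoly k / (s.mutate k).cluster k) i = s.cluster i
    rw [h.exchangePoly_mutate_self]
    by_cases hi : i = k
    · subst hi
      simp only [Seed.mutate, Function.update_self]
      rw [div_div_cancel₀ (h.exchangePoly_ne_zero i)]
    · simp [Seed.mutate, hi]
  · funext i r
    by_cases hi : i = k
    · subst hi
      rw [mutate_coef_self, mutate_coef_self, Fin.rev_rev]
    · rw [mutate_coef_of_ne _ hi, mutate_coef_of_ne _ hi]

/-! ### Nondegeneracy from the rank hypotheses -/

lemma linearIndependent_row_of_rank_eq {m : ℕ} {ι : Type*} [Fintype ι]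
    {A : Matrix (Fin m) ι ℚ} (h : A.rank = m) : LinearIndependent ℚ A.row := by
  rw [linearIndependent_iff_card_eq_finrank_span, Fintype.card_fin, Set.finrank,
    ← Matrix.rank_eq_finrank_span_row, h]

lemma algebraicIndependent_stableVar : AlgebraicIndependent ℚ (stableVar N M) := by
  have h1 : AlgebraicIndependent ℚ fun i : Fin N ⊕ Fin M =>
      algebraMap (MvPolynomial (Fin N ⊕ Fin M) ℚ) (Ambient N M) (MvPolynomial.X i) :=
    (MvPolynomial.algebraicIndependent_X _ ℚ).map' (f := IsScalarTower.toAlgHom ℚ _ _)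
      (IsFractionRing.injective _ _)
  exact h1.comp _ Sum.inr_injective

lemma sum_fin_eq_sum_inner {n : ℕ} (hn : 0 < n) {f : Fin (n + 1) → ℚ} (h0 : f 0 = 0)
    (hl : f (Fin.last n) = 0) : ∑ r, f r = ∑ r : Fin (n - 1), f ⟨r + 1, by omega⟩ := by
  obtain ⟨m, rfl⟩ : ∃ m, n = m + 1 := ⟨n - 1, by omega⟩
  rw [Fin.sum_univ_succ, h0, Fin.sum_univ_castSucc, Fin.succ_last, hl, zero_add, add_zero]
  rfl

/-- A seed that satisfies the two rank conditions is nondegenerate. -/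
lemma IsSeed.nondegenerate (hs : s.IsSeed) (hrank : (s.B.map (Int.cast : ℤ → ℚ)).rank = N)
    (hstring : ∀ i, d i ≠ 1 → ((s.stringMatrix i).map (Int.cast : ℤ → ℚ)).rank = d i - 1) :
    s.Nondegenerate {j | s.IsIsolated j} where
  indep := by
    refine algebraicIndependent_stableVar.sumElim_of_tower (S := stableField N M) ?_
      hs.transcendence.1
    rintro _ ⟨j, rfl⟩
    exact ⟨⟨_, IntermediateField.subset_adjoin _ _ ⟨j, rfl⟩⟩, rfl⟩
  skew := hs.skew
  d_pos := hs.d_pos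
  d_dvd := hs.d_dvd
  coef_zero := hs.coef_zero
  coef_last := hs.coef_last
  rows c hc := by
    have h := linearIndependent_row_of_rank_eq hrank
    rw [Fintype.linearIndependent_iff] at h
    funext i
    refine h c ?_ i
    ext l
    simpa using hc l
  isolated j hj := hj
  strings i c h0 hl hc := by
    classical
    have h : LinearIndependent ℚ ((s.stringMatrix i).map (Int.cast : ℤ → ℚ)).row := by
      -- The matrix of a trivial string has no rows, so no hypothesis is needed for it.
      by_cases hd : d i = 1
      · have : IsEmpty (Fin (d i - 1)) := by rw [hd]; exact Fin.isEmpty'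
        exact linearIndependent_empty_type
      · exact linearIndependent_row_of_rank_eq (hstring i hd)
    rw [Fintype.linearIndependent_iff] at h
    have key := h (fun r => c ⟨r + 1, by omega⟩) ?_
    · funext r
      by_cases hr0 : r = 0
      · rw [hr0, h0]; rfl
      by_cases hrl : r = Fin.last _
      · rw [hrl, hl]; rfl
      have h1 : (r : ℕ) ≠ 0 := fun h => hr0 (Fin.ext h)
      have h2 : (r : ℕ) ≠ d i := fun h => hrl (Fin.ext h)
      have := key ⟨r - 1, by omega⟩
      refine Eq.trans (congrArg c (Fin.ext ?_)) this
      simp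
      omega
    · ext ⟨j, hj⟩
      have h1 := hc j hj
      rw [sum_fin_eq_sum_inner (hs.d_pos i) (by rw [h0, zero_mul]) (by rw [hl, zero_mul])] at h1
      simpa [stringMatrix] using h1

variable {t : Seed N M d} {S : Set (Fin M)}

/-! ### Laurent rings -/

/-- The Laurent ring of a cluster over the ground ring, as a subring of the ambient field. -/
def laurent (S : Set (Fin M)) (s : Seed N M d) : Subring (Ambient N M) :=
  (laurentRing (groundRing N M S) s).toSubring

lemma mem_laurent {f : Ambient N M} :
    f ∈ s.laurent S ↔ f ∈ laurentRing (groundRing N M S) s := Iff.rfl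

lemma laurent_congr (h : s.cluster = t.cluster) : s.laurent S = t.laurent S := by
  rw [laurent, laurent, laurentRing, laurentRing, h]

/-- The variables that are invertible in the Laurent ring. -/
def invertibleVars (N : ℕ) (S : Set (Fin M)) : Set (Fin N ⊕ Fin M) :=
  {i | ∀ j, i = Sum.inr j → j ∈ S}

lemma groundRing_le_laurent : groundRing N M S ≤ s.laurent S := fun f hf =>
  (laurentRing (groundRing N M S) s).algebraMap_mem ⟨f, hf⟩

lemma vars_mem_laurent (i) : s.vars i ∈ s.laurent S := by
  rcases i with i | j
  · exact Algebra.subset_adjoin (Or.inl ⟨i, rfl⟩)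
  · exact groundRing_le_laurent (Subring.subset_closure (Or.inl ⟨j, rfl⟩))

lemma inv_vars_mem_laurent {i} (hi : i ∈ invertibleVars N S) : (s.vars i)⁻¹ ∈ s.laurent S := by
  rcases i with i | j
  · exact Algebra.subset_adjoin (Or.inr ⟨i, rfl⟩)
  · exact groundRing_le_laurent (Subring.subset_closure (Or.inr ⟨j, hi j rfl, rfl⟩))

lemma laurent_le {T : Subring (Ambient N M)} (h : ∀ i, s.vars i ∈ T)
    (h' : ∀ i ∈ invertibleVars N S, (s.vars i)⁻¹ ∈ T) : s.laurent S ≤ T := by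
  have hg : groundRing N M S ≤ T := by
    refine Subring.closure_le.2 ?_
    rintro _ (⟨j, rfl⟩ | ⟨j, hj, rfl⟩)
    · exact h (Sum.inr j)
    · exact h' (Sum.inr j) fun j' hj' => by rwa [← Sum.inr_injective hj']
  intro f hf
  rw [mem_laurent, laurentRing] at hf
  induction hf using Algebra.adjoin_induction with
  | mem x hx =>
    rcases hx with ⟨i, rfl⟩ | ⟨i, rfl⟩
    · exact h (Sum.inl i)
    · exact h' (Sum.inl i) fun j hj => by simp at hj
  | algebraMap r => exact hg r.2
  | add x y _ _ hx hy => exact T.add_mem hx hy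
  | mul x y _ _ hx hy => exact T.mul_mem hx hy

lemma invertibleVars_mono {S S' : Set (Fin M)} (h : S ⊆ S') :
    invertibleVars N S ⊆ invertibleVars N S' := fun _ hi j hj => h (hi j hj)

lemma mem_invertibleVars_univ (i) : i ∈ invertibleVars N (Set.univ : Set (Fin M)) :=
  fun _ _ => Set.mem_univ _

lemma laurent_mono {S S' : Set (Fin M)} (h : S ⊆ S') : s.laurent S ≤ s.laurent S' :=
  laurent_le vars_mem_laurent fun _ hi => inv_vars_mem_laurent (invertibleVars_mono h hi)

lemma ev_mem_laurent (p) : s.ev p ∈ s.laurent S := by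
  induction p using MvPolynomial.induction_on with
  | C a =>
    have : s.ev (MvPolynomial.C a) = (a : Ambient N M) := by simp [ev]
    rw [this]
    exact intCast_mem _ a
  | add p q hp hq => rw [map_add]; exact Subring.add_mem _ hp hq
  | mul_X p i hp => rw [map_mul, ev_X]; exact Subring.mul_mem _ hp (vars_mem_laurent i)

/-- The value of a formal polynomial as an element of the Laurent ring. -/
def evLaurent (S : Set (Fin M)) (s : Seed N M d) (p : MvPolynomial (Fin N ⊕ Fin M) ℤ) :
    s.laurent S := ⟨s.ev p, ev_mem_laurent p⟩

open Classical in
/-- The product of the invertible variables. -/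
def invertibleProd (N : ℕ) (S : Set (Fin M)) : MvPolynomial (Fin N ⊕ Fin M) ℤ :=
  ∏ i with i ∈ invertibleVars N S, MvPolynomial.X i

/-- Presents the Laurent ring as a localization of a polynomial ring over `ℤ`, so that divisibility
questions can be settled in a factorial ring. -/
lemma Nondegenerate.laurent_eq_saturation (h : s.Nondegenerate I) :
    s.laurent S = saturation s.ev.range ⟨s.ev (invertibleProd N S), _, rfl⟩ := by
  classical
  refine le_antisymm (laurent_le (fun i => ?_) fun i hi => ?_) ?_
  · exact le_saturation _ _ ⟨MvPolynomial.X i, ev_X s i⟩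
  · refine inv_mem_saturation (g := s.ev
      (∏ i ∈ (Finset.univ.filter (· ∈ invertibleVars N S)).erase i, MvPolynomial.X i)) ⟨_, rfl⟩ ?_
    rw [← ev_X s, ← map_mul, Finset.mul_prod_erase _ _ (by simpa using hi)]
    rfl
  · rintro f ⟨n, p, hp⟩
    have hne : s.ev (invertibleProd N S) ≠ 0 := by
      simp [invertibleProd, map_prod, Finset.prod_ne_zero_iff, h.vars_ne_zero]
    have hinv : (s.ev (invertibleProd N S))⁻¹ ∈ s.laurent S := by
      rw [invertibleProd, map_prod, ← Finset.prod_inv_distrib]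
      refine Subring.prod_mem _ fun i hi => ?_
      rw [ev_X]
      exact inv_vars_mem_laurent (by simpa using hi)
    have : f = (s.ev (invertibleProd N S))⁻¹ ^ n * s.ev p := by
      rw [hp, inv_pow, inv_mul_cancel_left₀ (pow_ne_zero n hne)]
    rw [this]
    exact Subring.mul_mem _ (Subring.pow_mem _ hinv n) (ev_mem_laurent p)

lemma Nondegenerate.mem_laurent_of_isRelPrime (h : s.Nondegenerate I)
    {p q : MvPolynomial (Fin N ⊕ Fin M) ℤ} (hp : p ≠ 0) (hpq : IsRelPrime p q) {f : Ambient N M}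
    (hfp : f ∈ saturation (s.laurent S) (s.evLaurent S p))
    (hfq : f ∈ saturation (s.laurent S) (s.evLaurent S q)) : f ∈ s.laurent S := by
  obtain ⟨a, ha⟩ := hfp
  obtain ⟨b, hb⟩ := hfq
  change s.ev p ^ a * f ∈ _ at ha
  change s.ev q ^ b * f ∈ _ at hb
  rw [h.laurent_eq_saturation] at ha hb ⊢
  obtain ⟨n, hn⟩ := ha
  obtain ⟨m, hm⟩ := hb
  refine ⟨n + m, mem_range_of_isRelPrime s.ev h.ev_injective (pow_ne_zero a hp)
    (hpq.pow (m := a) (n := b)) ?_ ?_⟩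
  · have h1 := Subring.mul_mem _ (⟨invertibleProd N S ^ m, rfl⟩ :
      s.ev (invertibleProd N S ^ m) ∈ s.ev.range) hn
    convert h1 using 1
    simp only [map_pow]
    ring
  · have h1 := Subring.mul_mem _ (⟨invertibleProd N S ^ n, rfl⟩ :
      s.ev (invertibleProd N S ^ n) ∈ s.ev.range) hm
    convert h1 using 1
    simp only [map_pow]
    ring

/-- To be in the Laurent ring over the ground ring, it suffices to be in the Laurent ring with all
stable variables inverted and to be moved into the Laurent ring by powers of an exchange
polynomial. -/
lemma Nondegenerate.mem_laurent_of_univ (h : s.Nondegenerate I) (k : Fin N) {f : Ambient N M}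
    (hf : f ∈ s.laurent Set.univ)
    (hf' : f ∈ saturation (s.laurent S) (s.evLaurent S (s.exPoly k))) : f ∈ s.laurent S := by
  classical
  -- Two denominators are available: the product of the stable variables and the exchange
  -- polynomial. They are relatively prime because no variable divides the latter.
  refine h.mem_laurent_of_isRelPrime (p := ∏ j : Fin M, MvPolynomial.X (Sum.inr j))
    (Finset.prod_ne_zero_iff.2 fun j _ => MvPolynomial.X_ne_zero _) ?_ ?_ hf'
  · refine IsRelPrime.prod_left fun j _ => ?_
    exact (MvPolynomial.X_prime.irreducible.isRelPrime_iff_not_dvd).2 (h.not_X_dvd_exPoly k _)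
  · refine laurent_le (fun i => le_saturation _ _ (vars_mem_laurent i)) (fun i _ => ?_) hf
    rcases i with i | j
    · exact le_saturation _ _ (inv_vars_mem_laurent fun j hj => by simp at hj)
    · refine inv_mem_saturation (g := s.ev
        (∏ i ∈ Finset.univ.erase j, MvPolynomial.X (Sum.inr i))) (ev_mem_laurent _) ?_
      rw [← ev_X s, ← map_mul,
        Finset.mul_prod_erase _ (fun i => MvPolynomial.X (Sum.inr i)) (Finset.mem_univ _)]
      rfl

/-- The only generator of the adjacent ring that may lie outside the Laurent ring of `s` is the
inverse of `x_k'`, and `x_k'` divides the exchange polynomial there. -/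
lemma Nondegenerate.laurent_mutate_le (h : s.Nondegenerate I) (k : Fin N) :
    (s.mutate k).laurent S ≤ saturation (s.laurent S) (s.evLaurent S (s.exPoly k)) := by
  have hself : (s.mutate k).vars (Sum.inl k) * s.vars (Sum.inl k) = s.evLaurent S (s.exPoly k) := by
    rw [vars_mutate_self, div_mul_cancel₀ _ (h.vars_ne_zero _), h.exchangePoly_eq]
    rfl
  have hinl : ∀ i : Fin N, Sum.inl i ∈ invertibleVars N S := fun i j hj => by simp at hj
  refine laurent_le (fun i => ?_) fun i hi => ?_
  · by_cases hik : i = Sum.inl k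
    · subst hik
      refine le_saturation _ _ ?_
      rw [vars_mutate_self, h.exchangePoly_eq, div_eq_mul_inv]
      exact Subring.mul_mem _ (ev_mem_laurent _) (inv_vars_mem_laurent (hinl k))
    · rw [vars_mutate_of_ne _ hik]
      exact le_saturation _ _ (vars_mem_laurent i)
  · by_cases hik : i = Sum.inl k
    · subst hik
      exact inv_mem_saturation (vars_mem_laurent _) hself
    · rw [vars_mutate_of_ne _ hik]
      exact le_saturation _ _ (inv_vars_mem_laurent hi)

/-! ### Commuting mutations -/

lemma Nondegenerate.exchangePoly_mutate_of_eq_zero (h : s.Nondegenerate I) {j k : Fin N}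
    (hjk : j ≠ k) (hB : s.B j (Sum.inl k) = 0) :
    (s.mutate k).exchangePoly j = s.exchangePoly j := by
  rw [(h.mutate k).exchangePoly_eq, h.exchangePoly_eq, ev_exPoly_eq_sum, ev_exPoly_eq_sum]
  refine Finset.sum_congr rfl fun r _ => Finset.prod_congr rfl fun i _ => ?_
  have hBi : (s.mutate k).B j i = s.B j i := by
    rw [mutate_B]
    by_cases hi : i = Sum.inl k
    · subst hi
      rw [matrixMutation_self_col, hB, neg_zero]
    · rw [matrixMutation_of_ne _ hjk hi, hB]
      simp
  have : (s.mutate k).expoFinsupp j r i = s.expoFinsupp j r i := by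
    simp [expoFinsupp, expo, hBi, mutate_coef_of_ne _ hjk]
  rw [this]
  by_cases hi : i = Sum.inl k
  · have : s.expoFinsupp j r i = 0 := by
      zify
      rw [cast_expoFinsupp _ h.d_pos, hi, expo, hB]
      simp
    rw [this, pow_zero, pow_zero]
  · rw [vars_mutate_of_ne _ hi]

lemma Nondegenerate.apply_eq_zero_symm (h : s.Nondegenerate I) {j k : Fin N}
    (hB : s.B j (Sum.inl k) = 0) : s.B k (Sum.inl j) = 0 := by
  have h1 := h.skew.pos_iff j k
  have h2 := h.skew.pos_iff k j
  omega

/-- Neither of `x_j`, `x_k` occurs in the exchange polynomial of the other, so both exchange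
polynomials are unaffected by the other mutation. Clusters suffice, since Laurent rings depend on
nothing else. -/
lemma Nondegenerate.cluster_mutate_mutate_mutate (h : s.Nondegenerate I) {j k : Fin N}
    (hjk : j ≠ k) (hB : s.B j (Sum.inl k) = 0) :
    (((s.mutate k).mutate j).mutate k).cluster = (s.mutate j).cluster := by
  have hB' : (s.mutate k).B k (Sum.inl j) = 0 := by
    rw [mutate_B, matrixMutation_self_row, h.apply_eq_zero_symm hB, neg_zero]
  have e1 : ((s.mutate k).mutate j).exchangePoly k = s.exchangePoly k := by
    rw [(h.mutate k).exchangePoly_mutate_of_eq_zero hjk.symm hB', h.exchangePoly_mutate_self]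
  have e2 := h.exchangePoly_mutate_of_eq_zero hjk hB
  have hm : ∀ (t : Seed N M d) (l : Fin N), (t.mutate l).cluster =
    Function.update t.cluster l (t.exchangePoly l / t.cluster l) := fun _ _ => rfl
  rw [hm, e1, hm (s.mutate k), e2, hm s k, Function.update_of_ne hjk,
    Function.update_of_ne hjk.symm, Function.update_self, div_div_cancel₀ (h.exchangePoly_ne_zero k),
    hm s j]
  ext i
  by_cases hi : i = k
  · subst hi
    rw [Function.update_self, Function.update_of_ne hjk.symm]
  · rw [Function.update_of_ne hi]
    by_cases hij : i = j
    · subst hij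
      rw [Function.update_self, Function.update_self]
    · rw [Function.update_of_ne hij, Function.update_of_ne hij, Function.update_of_ne hi]

lemma Nondegenerate.mem_laurent_of_eq_zero (h : s.Nondegenerate I) {j k : Fin N}
    (hjk : j ≠ k) (hB : s.B j (Sum.inl k) = 0) {f : Ambient N M}
    (hk : f ∈ (s.mutate k).laurent S) (hj : f ∈ (s.mutate j).laurent S) :
    f ∈ ((s.mutate k).mutate j).laurent S := by
  have h1 := h.mutate k
  have h2 := h1.mutate j
  refine h2.mem_laurent_of_isRelPrime (h2.exPoly_ne_zero k) (h2.isRelPrime_exPoly hjk) ?_ ?_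
  · rw [← laurent_congr (h.cluster_mutate_mutate_mutate hjk hB)] at hj
    exact h2.laurent_mutate_le k hj
  · rw [← h1.mutate_mutate j] at hk
    exact h2.laurent_mutate_le j hk

/-! ### Laurent monomials -/

/-- The Laurent monomial in cluster and stable variables with exponents `e`. -/
def mon (s : Seed N M d) (e : Fin N ⊕ Fin M → ℤ) : Ambient N M := ∏ i, s.vars i ^ e i

lemma Nondegenerate.mon_add (h : s.Nondegenerate I) (e e' : Fin N ⊕ Fin M → ℤ) :
    s.mon (e + e') = s.mon e * s.mon e' := by
  simp [mon, zpow_add₀ (h.vars_ne_zero _), Finset.prod_mul_distrib]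

lemma mon_neg (e : Fin N ⊕ Fin M → ℤ) : s.mon (-e) = (s.mon e)⁻¹ := by
  simp [mon]

lemma Nondegenerate.mon_ne_zero (h : s.Nondegenerate I) (e : Fin N ⊕ Fin M → ℤ) :
    s.mon e ≠ 0 :=
  Finset.prod_ne_zero_iff.2 fun i _ => zpow_ne_zero _ (h.vars_ne_zero i)

lemma mon_smul (n : ℤ) (e : Fin N ⊕ Fin M → ℤ) : s.mon (n • e) = s.mon e ^ n := by
  simp [mon, zpow_mul', Finset.prod_zpow]

lemma mon_single (i : Fin N ⊕ Fin M) (n : ℤ) : s.mon (Pi.single i n) = s.vars i ^ n := by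
  rw [mon, Finset.prod_eq_single i]
  · simp
  · intro j _ hj
    simp [hj]
  · simp

/-- The subring of Laurent polynomials in the variables with index in `A`. -/
def partialLaurent (s : Seed N M d) (A : Set (Fin N ⊕ Fin M)) : Subring (Ambient N M) :=
  Subring.closure (s.vars '' A ∪ (fun i => (s.vars i)⁻¹) '' A)

lemma vars_mem_partialLaurent {A : Set (Fin N ⊕ Fin M)} {i} (hi : i ∈ A) :
    s.vars i ∈ s.partialLaurent A :=
  Subring.subset_closure (Or.inl (Set.mem_image_of_mem _ hi))

lemma inv_vars_mem_partialLaurent {A : Set (Fin N ⊕ Fin M)} {i} (hi : i ∈ A) :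
    (s.vars i)⁻¹ ∈ s.partialLaurent A :=
  Subring.subset_closure (Or.inr (Set.mem_image_of_mem _ hi))

lemma partialLaurent_le {A : Set (Fin N ⊕ Fin M)} {T : Subring (Ambient N M)}
    (h : ∀ i ∈ A, s.vars i ∈ T) (h' : ∀ i ∈ A, (s.vars i)⁻¹ ∈ T) : s.partialLaurent A ≤ T := by
  refine Subring.closure_le.2 ?_
  rintro _ (⟨i, hi, rfl⟩ | ⟨i, hi, rfl⟩)
  · exact h i hi
  · exact h' i hi

lemma partialLaurent_mono {A A' : Set (Fin N ⊕ Fin M)} (h : A ⊆ A') :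
    s.partialLaurent A ≤ s.partialLaurent A' :=
  partialLaurent_le (fun _ hi => vars_mem_partialLaurent (h hi))
    fun _ hi => inv_vars_mem_partialLaurent (h hi)

lemma mon_mem_partialLaurent {A : Set (Fin N ⊕ Fin M)} {e : Fin N ⊕ Fin M → ℤ}
    (he : ∀ i ∉ A, e i = 0) : s.mon e ∈ s.partialLaurent A := by
  refine Subring.prod_mem _ fun i _ => ?_
  by_cases hi : i ∈ A
  · rcases le_total 0 (e i) with h | h
    · lift e i to ℕ using h with n
      rw [zpow_natCast]
      exact Subring.pow_mem _ (vars_mem_partialLaurent hi) _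
    · obtain ⟨n, hn⟩ := Int.eq_ofNat_of_zero_le (neg_nonneg.2 h)
      rw [show e i = -(n : ℤ) by omega, zpow_neg, zpow_natCast, ← inv_pow]
      exact Subring.pow_mem _ (inv_vars_mem_partialLaurent hi) _
  · rw [he i hi, zpow_zero]
    exact Subring.one_mem _

lemma Nondegenerate.exchangePoly_eq_sum_mon (h : s.Nondegenerate I) (k : Fin N) :
    s.exchangePoly k = ∑ r, s.mon (s.expo k r) := by
  rw [h.exchangePoly_eq, ev_exPoly_eq_sum]
  refine Finset.sum_congr rfl fun r _ => Finset.prod_congr rfl fun i _ => ?_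
  rw [← cast_expoFinsupp _ h.d_pos, zpow_natCast]

/-- The ring of polynomials in `y` over a ring of Laurent polynomials. -/
def partialPoly (s : Seed N M d) (A : Set (Fin N ⊕ Fin M)) (y : Ambient N M) :
    Subring (Ambient N M) :=
  s.partialLaurent A ⊔ Subring.closure {y}

lemma mem_partialPoly_self {A : Set (Fin N ⊕ Fin M)} {y : Ambient N M} :
    y ∈ s.partialPoly A y :=
  (le_sup_right : _ ≤ s.partialPoly A y) (Subring.subset_closure rfl)

lemma partialLaurent_le_partialPoly {A : Set (Fin N ⊕ Fin M)} {y : Ambient N M} :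
    s.partialLaurent A ≤ s.partialPoly A y := le_sup_left

lemma partialPoly_le {A : Set (Fin N ⊕ Fin M)} {y : Ambient N M} {T : Subring (Ambient N M)}
    (h : s.partialLaurent A ≤ T) (hy : y ∈ T) : s.partialPoly A y ≤ T :=
  sup_le h (Subring.closure_le.2 (by simpa using hy))

/-! ### Adjacent mutations that do not commute -/

/-- The exponents of the monomial of the `k`th exchange polynomial that does not contain the
`j`th cluster variable. -/
def leadExpo (s : Seed N M d) (j k : Fin N) (i : Fin N ⊕ Fin M) : ℤ :=
  if 0 < s.B j (Sum.inl k) then max (s.B k i) 0 else max (-s.B k i) 0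

lemma Nondegenerate.leadExpo_self (h : s.Nondegenerate I) (j k : Fin N) :
    s.leadExpo j k (Sum.inl k) = 0 := by
  simp [leadExpo, h.skew.diag]

lemma Nondegenerate.leadExpo_left (h : s.Nondegenerate I) (j k : Fin N) :
    s.leadExpo j k (Sum.inl j) = 0 := by
  have h1 := h.skew.pos_iff j k
  have h2 := h.skew.pos_iff k j
  rw [leadExpo]
  split_ifs <;> omega

/-- Modulo the `j`th cluster variable, the `k`th exchange polynomial is a monomial. -/
lemma Nondegenerate.exists_exchangePoly_eq (h : s.Nondegenerate I) {j k : Fin N} (hjk : j ≠ k)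
    (hB : s.B j (Sum.inl k) ≠ 0) :
    ∃ w ∈ s.partialPoly {Sum.inl j, Sum.inl k}ᶜ (s.vars (Sum.inl j)),
      s.exchangePoly k = s.mon (s.leadExpo j k) * (1 + s.vars (Sum.inl j) * w) := by
  classical
  set W := s.partialPoly {Sum.inl j, Sum.inl k}ᶜ (s.vars (Sum.inl j)) with hW
  -- Since `d k` divides `b_kj`, the exponent of `x_j` is affine in `r`. It vanishes at exactly one
  -- end of the string: at `r = d k` if `b_kj < 0`, at `r = 0` if `b_kj > 0`.
  have hlead : ∃ r₀, s.expo k r₀ = s.leadExpo j k ∧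
      ∀ r ≠ r₀, 0 < s.expo k r (Sum.inl j) := by
    obtain ⟨c, hc⟩ := h.d_dvd k j
    have hdk : (0 : ℤ) < d k := by have := h.d_pos k; omega
    have hexp : ∀ r, s.expo k r (Sum.inl j) = r * c + max (-(d k * c)) 0 := by
      intro r
      rw [expo, hc, mul_left_comm, Int.mul_ediv_cancel_left _ hdk.ne']
      simp
    have h1 := h.skew.pos_iff j k
    have h2 := h.skew.pos_iff k j
    by_cases hpos : 0 < s.B j (Sum.inl k)
    · refine ⟨Fin.last _, ?_, fun r hr => ?_⟩
      · ext i
        rw [expo_last k (h.d_pos k) (h.coef_last k), leadExpo, if_pos hpos]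
      · have hneg := h1.1 hpos
        have hc0 : c < 0 := by
          by_contra h0
          have := mul_nonneg hdk.le (not_lt.1 h0)
          omega
        have hr' : (r : ℤ) < d k := by
          have : (r : ℕ) ≠ d k := fun h => hr (Fin.ext h)
          omega
        rw [hexp, max_eq_left (by omega)]
        nlinarith
    · have hpos' : 0 < s.B k (Sum.inl j) := h2.2 (by omega)
      refine ⟨0, ?_, fun r hr => ?_⟩
      · ext i
        rw [expo_zero k (h.coef_zero k), leadExpo, if_neg hpos]
      · have hc0 : 0 < c := by
          by_contra h0
          have := mul_nonpos_of_nonneg_of_nonpos hdk.le (not_lt.1 h0)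
          omega
        have hr' : (0 : ℤ) < r := by
          have : (r : ℕ) ≠ 0 := fun h => hr (Fin.ext h)
          omega
        rw [hexp]
        have := mul_pos hr' hc0
        have := le_max_right (-(d k * c)) 0
        omega
  obtain ⟨r₀, hr₀, hr₀'⟩ := hlead
  have hterm : ∀ r ≠ r₀, ∃ g ∈ W, s.mon (s.expo k r) = s.vars (Sum.inl j) * g := by
    intro r hr
    have hp := hr₀' r hr
    have hsplit : s.expo k r = Pi.single (Sum.inl j) (s.expo k r (Sum.inl j)) +
        Function.update (s.expo k r) (Sum.inl j) 0 := by
      ext i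
      by_cases hi : i = Sum.inl j
      · subst hi; simp
      · simp [hi]
    obtain ⟨n, hn⟩ : ∃ n : ℕ, s.expo k r (Sum.inl j) = n + 1 :=
      ⟨(s.expo k r (Sum.inl j) - 1).toNat, by omega⟩
    refine ⟨s.vars (Sum.inl j) ^ n * s.mon (Function.update (s.expo k r) (Sum.inl j) 0), ?_, ?_⟩
    · refine W.mul_mem (W.pow_mem mem_partialPoly_self n)
        (partialLaurent_le_partialPoly (mon_mem_partialLaurent fun i hi => ?_))
      simp only [Set.mem_compl_iff, not_not, Set.mem_insert_iff, Set.mem_singleton_iff] at hi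
      rcases hi with rfl | rfl
      · simp
      · rw [Function.update_of_ne (by simpa using hjk.symm), h.expo_self]
    · conv_lhs => rw [hsplit, h.mon_add, mon_single, hn]
      rw [zpow_add_one₀ (h.vars_ne_zero _), zpow_natCast]
      ring
  choose! g hg hg' using hterm
  refine ⟨s.mon (-s.leadExpo j k) * ∑ r ∈ Finset.univ.erase r₀, g r, ?_, ?_⟩
  · refine W.mul_mem (partialLaurent_le_partialPoly (mon_mem_partialLaurent fun i hi => ?_))
      (W.sum_mem fun r hr => hg r (Finset.ne_of_mem_erase hr))
    simp only [Set.mem_compl_iff, not_not, Set.mem_insert_iff, Set.mem_singleton_iff] at hi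
    rcases hi with rfl | rfl
    · simp [h.leadExpo_left]
    · simp [h.leadExpo_self]
  · rw [h.exchangePoly_eq_sum_mon, ← Finset.add_sum_erase _ _ (Finset.mem_univ r₀), hr₀,
      Finset.sum_congr rfl fun r hr => hg' r (Finset.ne_of_mem_erase hr), ← Finset.mul_sum, mon_neg]
    have := h.mon_ne_zero (s.leadExpo j k)
    field_simp

/-- The exponents of the monomial factor that relates the `j`th exchange polynomials before and
after a mutation in direction `k`. -/
def shiftExpo (s : Seed N M d) (j k : Fin N) (i : Fin N ⊕ Fin M) : ℤ :=
  if i = Sum.inl k then -|s.B j (Sum.inl k)|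
  else max (-(s.mutate k).B j i) 0 - max (-s.B j i) 0 +
    max (s.B j (Sum.inl k)) 0 * s.leadExpo j k i

lemma mutate_B_eq {j k : Fin N} (hjk : j ≠ k)
    (hB : s.B j (Sum.inl k) ≠ 0) {i} (hi : i ≠ Sum.inl k) :
    (s.mutate k).B j i = s.B j i + s.B j (Sum.inl k) * s.leadExpo j k i := by
  rw [mutate_B, matrixMutation_of_ne _ hjk hi, half_abs_mul, leadExpo]
  split_ifs <;> first | rfl | omega

/-- Replacing `x_k'` by its leading part, the monomial `leadExpo` over `x_k`, turns the `r`th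
monomial of the new polynomial into the `r`th old one times a factor independent of `r`. As `d j`
divides `b_jk`, the change of row `j` leaves the floor as the integer `r * c * leadExpo`, which the
power of `x_k'` cancels. -/
lemma Nondegenerate.expo_mutate (h : s.Nondegenerate I) {j k : Fin N} (hjk : j ≠ k)
    (hB : s.B j (Sum.inl k) ≠ 0) (r) :
    (Function.update ((s.mutate k).expo j r) (Sum.inl k) 0 +
      (s.mutate k).expo j r (Sum.inl k) • (s.leadExpo j k - Pi.single (Sum.inl k) 1)) =
      s.expo j r + s.shiftExpo j k := by
  obtain ⟨c, hc⟩ := h.d_dvd j k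
  have hd' : (d j : ℤ) ≠ 0 := by have := h.d_pos j; omega
  have he : (s.mutate k).expo j r (Sum.inl k) =
      -(r * c) + max (s.B j (Sum.inl k)) 0 := by
    rw [expo, mutate_B, matrixMutation_self_col, hc, ← mul_neg, mul_left_comm,
      Int.mul_ediv_cancel_left _ hd']
    simp
  ext i
  simp only [Pi.add_apply, Pi.smul_apply, Pi.sub_apply, smul_eq_mul, he]
  by_cases hi : i = Sum.inl k
  · subst hi
    have e1 : s.expo j r (Sum.inl k) = r * c + max (-s.B j (Sum.inl k)) 0 := by
      rw [expo, hc, mul_left_comm, Int.mul_ediv_cancel_left _ hd']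
      simp
    rw [Function.update_self, h.leadExpo_self, Pi.single_eq_same, e1, shiftExpo, if_pos rfl]
    rcases le_total 0 (s.B j (Sum.inl k)) with hp | hp
    · rw [abs_of_nonneg hp, max_eq_left hp, max_eq_right (by omega)]; ring
    · rw [abs_of_nonpos hp, max_eq_right hp, max_eq_left (by omega)]; ring
  · rw [Function.update_of_ne hi, Pi.single_eq_of_ne hi, shiftExpo, if_neg hi, expo, expo,
      mutate_coef_of_ne _ hjk]
    have e2 : (r : ℤ) * (s.mutate k).B j i / d j =
        r * s.B j i / d j + r * c * s.leadExpo j k i := by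
      rw [mutate_B_eq hjk hB hi, hc, ← Int.add_mul_ediv_right _ _ hd']
      congr 1
      ring
    rw [e2]
    ring

/-- Comparison of the `j`th exchange polynomials before and after a mutation in direction `k`. -/
lemma Nondegenerate.exists_exchangePoly_mutate_eq (h : s.Nondegenerate I) {j k : Fin N}
    (hjk : j ≠ k) (hB : s.B j (Sum.inl k) ≠ 0) :
    ∃ g ∈ s.partialPoly {Sum.inl j}ᶜ (s.vars (Sum.inl j)),
      (s.mutate k).exchangePoly j =
        s.mon (s.shiftExpo j k) * (s.exchangePoly j + s.vars (Sum.inl j) * g) := by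
  obtain ⟨w, hw, hP⟩ := h.exists_exchangePoly_eq hjk hB
  set y := s.vars (Sum.inl j) with hy
  set W := s.partialPoly {Sum.inl j}ᶜ y with hW
  have hwW : w ∈ W := by
    refine partialPoly_le ((partialLaurent_mono ?_).trans partialLaurent_le_partialPoly)
      mem_partialPoly_self hw
    exact Set.compl_subset_compl.2 (by simp)
  -- By `hP`, the variable `x_k'` is a monomial times `1 + y * w`. It enters the new exchange
  -- polynomial with nonnegative exponents only, and powers of `1 + y * w` remain `1` modulo `y`.
  have hpow : ∀ n : ℕ, ∃ g ∈ W, (1 + y * w) ^ n = 1 + y * g := by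
    intro n
    induction n with
    | zero => exact ⟨0, W.zero_mem, by simp⟩
    | succ n ih =>
      obtain ⟨g, hg, hgn⟩ := ih
      refine ⟨g + w + y * g * w, W.add_mem (W.add_mem hg hwW)
        (W.mul_mem (W.mul_mem mem_partialPoly_self hg) hwW), ?_⟩
      rw [pow_succ, hgn]
      ring
  choose g hg hg' using hpow
  have hterm : ∀ r, (s.mutate k).mon ((s.mutate k).expo j r) = s.mon (s.shiftExpo j k) *
      (s.mon (s.expo j r) +
        y * (s.mon (s.expo j r) * g ((s.mutate k).expoFinsupp j r (Sum.inl k)))) := by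
    intro r
    have h1 : (s.mutate k).mon ((s.mutate k).expo j r) =
        s.mon (Function.update ((s.mutate k).expo j r) (Sum.inl k) 0) *
          (s.mutate k).vars (Sum.inl k) ^ (s.mutate k).expo j r (Sum.inl k) := by
      rw [mon, ← Finset.mul_prod_erase _ _ (Finset.mem_univ (Sum.inl k)), mon,
        ← Finset.mul_prod_erase _ _ (Finset.mem_univ (Sum.inl k)), Function.update_self, zpow_zero,
        one_mul, mul_comm]
      congr 1
      refine Finset.prod_congr rfl fun i hi => ?_
      have hi' := Finset.ne_of_mem_erase hi
      rw [vars_mutate_of_ne _ hi', Function.update_of_ne hi']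
    have h2 : (s.mutate k).vars (Sum.inl k) =
        s.mon (s.leadExpo j k - Pi.single (Sum.inl k) 1) * (1 + y * w) := by
      rw [vars_mutate_self, hP, sub_eq_add_neg, h.mon_add, mon_neg, mon_single, zpow_one]
      ring
    rw [h1, h2, mul_zpow, ← mon_smul, ← mul_assoc, ← h.mon_add, h.expo_mutate hjk hB, h.mon_add,
      ← cast_expoFinsupp _ h.d_pos, zpow_natCast, hg']
    ring
  refine ⟨∑ r, s.mon (s.expo j r) * g ((s.mutate k).expoFinsupp j r (Sum.inl k)),
    W.sum_mem fun r _ => W.mul_mem (partialLaurent_le_partialPoly (mon_mem_partialLaurent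
      fun i hi => ?_)) (hg _), ?_⟩
  · simp only [Set.mem_compl_iff, not_not, Set.mem_singleton_iff] at hi
    rw [hi, h.expo_self]
  · rw [(h.mutate k).exchangePoly_eq_sum_mon, h.exchangePoly_eq_sum_mon, Finset.mul_sum,
      ← Finset.sum_add_distrib, Finset.mul_sum]
    exact Finset.sum_congr rfl fun r _ => hterm r

/-! ### Expansion in one cluster variable -/

lemma Nondegenerate.transcendental (h : s.Nondegenerate I) (j : Fin N) :
    Transcendental (s.partialLaurent {Sum.inl j}ᶜ) (s.vars (Sum.inl j)) := by
  have h1 := ((AlgebraicIndependent.iff_transcendental_adjoin_image (Sum.inl j)).1 h.indep).2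
  -- The coefficients involve inverses, so transcendence is first extended to the field generated by
  -- the other variables.
  rw [← IntermediateField.transcendental_adjoin_iff] at h1
  set E := IntermediateField.adjoin ℚ (s.vars '' {Sum.inl j}ᶜ) with hE
  have hmem : ∀ i ∈ ({Sum.inl j}ᶜ : Set (Fin N ⊕ Fin M)), s.vars i ∈ E := fun i hi =>
    IntermediateField.subset_adjoin _ _ (Set.mem_image_of_mem _ hi)
  have hle : s.partialLaurent {Sum.inl j}ᶜ ≤ E.toSubring :=
    partialLaurent_le hmem fun i hi => E.inv_mem (hmem i hi)
  let _ : Algebra (s.partialLaurent {Sum.inl j}ᶜ) E :=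
    (Subring.inclusion hle : _ →+* E.toSubring).toAlgebra
  have : IsScalarTower (s.partialLaurent {Sum.inl j}ᶜ) E (Ambient N M) :=
    IsScalarTower.of_algebraMap_eq fun _ => rfl
  exact h1.restrictScalars (Subring.inclusion_injective hle)

/-- An element of a Laurent ring is a Laurent polynomial in one variable. -/
lemma exists_pow_mul_eq_aeval {j : Fin N}
    (ht : ∀ i ≠ Sum.inl j, t.vars i = s.vars i) {f : Ambient N M}
    (hf : f ∈ t.laurent S) :
    ∃ (n : ℕ) (F : Polynomial (s.partialLaurent {Sum.inl j}ᶜ)),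
      t.vars (Sum.inl j) ^ n * f = Polynomial.aeval (t.vars (Sum.inl j)) F := by
  set y := t.vars (Sum.inl j) with hy
  let φ : Polynomial (s.partialLaurent {Sum.inl j}ᶜ) →+* Ambient N M :=
    (Polynomial.aeval y).toRingHom
  have hyφ : y ∈ φ.range := ⟨Polynomial.X, Polynomial.aeval_X _⟩
  have hC : ∀ r ∈ s.partialLaurent {Sum.inl j}ᶜ, r ∈ φ.range := fun r hr =>
    ⟨Polynomial.C ⟨r, hr⟩, Polynomial.aeval_C _ _⟩
  have hle : t.laurent S ≤ saturation φ.range ⟨y, hyφ⟩ := by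
    refine laurent_le (fun i => le_saturation _ _ ?_) fun i _ => ?_
    · by_cases hi : i = Sum.inl j
      · rw [hi]
        exact hyφ
      · rw [ht i hi]
        exact hC _ (vars_mem_partialLaurent hi)
    · by_cases hi : i = Sum.inl j
      · subst hi
        exact inv_mem_saturation (g := 1) (Subring.one_mem _) (mul_one _)
      · rw [ht i hi]
        exact le_saturation _ _ (hC _ (inv_vars_mem_partialLaurent hi))
  obtain ⟨n, F, hF⟩ := hle hf
  exact ⟨n, F, hF.symm⟩

lemma Nondegenerate.exchangePoly_mem_partialLaurent (h : s.Nondegenerate I) (j : Fin N) :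
    s.exchangePoly j ∈ s.partialLaurent {Sum.inl j}ᶜ := by
  rw [h.exchangePoly_eq_sum_mon]
  refine Subring.sum_mem _ fun r _ => mon_mem_partialLaurent fun i hi => ?_
  simp only [Set.mem_compl_iff, not_not, Set.mem_singleton_iff] at hi
  rw [hi, h.expo_self]

lemma Nondegenerate.mem_closure_of_mem_laurent (h : s.Nondegenerate I) (j : Fin N)
    {f : Ambient N M} (hf : f ∈ s.laurent S) (hfj : f ∈ (s.mutate j).laurent S) :
    f ∈ Subring.closure ((s.partialLaurent {Sum.inl j}ᶜ : Set (Ambient N M)) ∪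
      {s.vars (Sum.inl j), (s.mutate j).vars (Sum.inl j)}) := by
  obtain ⟨n, F, hF⟩ := exists_pow_mul_eq_aeval (s := s) (j := j) (fun _ _ => rfl) hf
  obtain ⟨m, G, hG⟩ := exists_pow_mul_eq_aeval (s := s) (j := j)
    (fun i hi => vars_mutate_of_ne _ hi) hfj
  refine mem_closure_of_laurent (p := ⟨_, h.exchangePoly_mem_partialLaurent j⟩) ?_ ?_
    (h.transcendental j) hF hG
  · exact fun h0 => h.exchangePoly_ne_zero j (congrArg Subtype.val h0)
  · rw [vars_mutate_self, mul_div_cancel₀ _ (h.vars_ne_zero _)]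

/-- The denominators are the `k`th exchange polynomial of `s` and the `j`th one of `t`. Inverting
all stable variables makes the leading monomial a unit, and thereby the two comaximal. -/
lemma Nondegenerate.mem_laurent_univ_of_ne_zero (h : s.Nondegenerate I) {j k : Fin N}
    (hjk : j ≠ k) (hB : s.B j (Sum.inl k) ≠ 0) {f : Ambient N M}
    (hf : f ∈ s.laurent Set.univ) (hk : f ∈ (s.mutate k).laurent Set.univ)
    (hj : f ∈ (s.mutate j).laurent Set.univ) :
    f ∈ ((s.mutate k).mutate j).laurent Set.univ := by
  have h1 := h.mutate k
  have h2 := h1.mutate j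
  set t := (s.mutate k).mutate j with ht
  set L := t.laurent Set.univ with hL
  set y := s.vars (Sum.inl j) with hy
  have hy0 : y ≠ 0 := h.vars_ne_zero _
  have hjk' : (Sum.inl j : Fin N ⊕ Fin M) ≠ Sum.inl k := by simpa using hjk
  have hQ : ((t.evLaurent Set.univ (t.exPoly j) : L) : Ambient N M) =
      (s.mutate k).exchangePoly j := by
    rw [← h1.exchangePoly_mutate_self j, h2.exchangePoly_eq]
    rfl
  have hinv : ∀ i, (t.vars i)⁻¹ ∈ L := fun i => inv_vars_mem_laurent (mem_invertibleVars_univ i)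
  have htj : t.vars (Sum.inl j) = (s.mutate k).exchangePoly j / y := by
    rw [ht, vars_mutate_self, vars_mutate_of_ne _ hjk']
  have htk : t.vars (Sum.inl k) = s.exchangePoly k / s.vars (Sum.inl k) := by
    rw [ht, vars_mutate_of_ne _ hjk'.symm, vars_mutate_self]
  have hti : ∀ i, i ≠ Sum.inl j → i ≠ Sum.inl k → t.vars i = s.vars i := fun i hi hi' => by
    rw [ht, vars_mutate_of_ne _ hi, vars_mutate_of_ne _ hi']
  have hyQ : y = (s.mutate k).exchangePoly j * (t.vars (Sum.inl j))⁻¹ := by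
    rw [htj, inv_div, mul_div_cancel₀ _ (h1.exchangePoly_ne_zero j)]
  have hyL : y ∈ L := by
    rw [hyQ, ← hQ]
    exact L.mul_mem (Subtype.prop _) (hinv _)
  have hpL : s.partialLaurent {Sum.inl j, Sum.inl k}ᶜ ≤ L := by
    refine partialLaurent_le (fun i hi => ?_) fun i hi => ?_ <;>
    · simp only [Set.mem_compl_iff, Set.mem_insert_iff, Set.mem_singleton_iff, not_or] at hi
      rw [← hti i hi.1 hi.2]
      first | exact vars_mem_laurent i | exact hinv i
  obtain ⟨w, hw, hP⟩ := h.exists_exchangePoly_eq hjk hB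
  have hwL : w ∈ L := partialPoly_le hpL hyL hw
  have hlead : ∀ i ∉ ({Sum.inl j, Sum.inl k}ᶜ : Set (Fin N ⊕ Fin M)), s.leadExpo j k i = 0 := by
    intro i hi
    simp only [Set.mem_compl_iff, not_not, Set.mem_insert_iff, Set.mem_singleton_iff] at hi
    rcases hi with rfl | rfl
    · exact h.leadExpo_left _ _
    · exact h.leadExpo_self _ _
  have hmL : s.mon (s.leadExpo j k) ∈ L := hpL (mon_mem_partialLaurent hlead)
  have hmL' : s.mon (-s.leadExpo j k) ∈ L :=
    hpL (mon_mem_partialLaurent fun i hi => by rw [Pi.neg_apply, hlead i hi, neg_zero])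
  have hPL : s.exchangePoly k ∈ L := by
    rw [hP]
    exact L.mul_mem hmL (L.add_mem L.one_mem (L.mul_mem hyL hwL))
  -- With `m` the leading monomial and `Q` the `j`th exchange polynomial of `t`, the relations `P_k
  -- = m (1 + y w)` and `y = Q / t_j` give `m⁻¹ P_k - (w / t_j) Q = 1`.
  have hcop : IsCoprime (⟨_, hPL⟩ : L) (t.evLaurent Set.univ (t.exPoly j)) := by
    refine ⟨⟨_, hmL'⟩, -⟨_, L.mul_mem hwL (hinv (Sum.inl j))⟩, Subtype.ext ?_⟩
    simp only [Subring.coe_add, Subring.coe_mul, Subring.coe_neg, Subring.coe_one, hQ]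
    rw [hP, mon_neg, inv_mul_cancel_left₀ (h.mon_ne_zero _)]
    linear_combination w * hyQ
  refine mem_of_mem_saturation_of_isCoprime hcop ?_ ?_
  · set T := saturation L ⟨_, hPL⟩ with hT
    have hxx : s.vars (Sum.inl k) * t.vars (Sum.inl k) = s.exchangePoly k := by
      rw [htk, mul_div_cancel₀ _ (h.vars_ne_zero _)]
    have hx : s.vars (Sum.inl k) = s.exchangePoly k * (t.vars (Sum.inl k))⁻¹ := by
      rw [← hxx, mul_inv_cancel_right₀ (h2.vars_ne_zero _)]
    have hpT : s.partialLaurent {Sum.inl j}ᶜ ≤ T := by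
      refine partialLaurent_le (fun i hi => ?_) fun i hi => ?_
      · by_cases hik : i = Sum.inl k
        · rw [hik, hx]
          exact le_saturation _ _ (L.mul_mem hPL (hinv _))
        · rw [← hti i hi hik]
          exact le_saturation _ _ (vars_mem_laurent i)
      · by_cases hik : i = Sum.inl k
        · rw [hik]
          exact inv_mem_saturation (vars_mem_laurent _) hxx
        · rw [← hti i hi hik]
          exact le_saturation _ _ (hinv i)
    obtain ⟨g, hg, hgQ⟩ := h.exists_exchangePoly_mutate_eq hjk hB
    have hyT : y ∈ T := le_saturation _ _ hyL
    have hgT : g ∈ T := partialPoly_le hpT hyT hg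
    have hshift : s.shiftExpo j k (Sum.inl j) = 0 := by
      rw [shiftExpo, if_neg hjk', h.leadExpo_left, mutate_B, (h.skew.matrixMutation k).diag,
        h.skew.diag]
      simp
    -- From `Q = m' (P_j + y g)`, with `m'` the shift monomial: division by `y` gives `t_j = m'
    -- (x_j' + g)`.
    have hy' : (s.mutate j).vars (Sum.inl j) =
        s.mon (-s.shiftExpo j k) * t.vars (Sum.inl j) - g := by
      rw [vars_mutate_self, htj, hgQ, mon_neg, ← hy]
      have := h.mon_ne_zero (s.shiftExpo j k)
      field_simp
      ring
    refine Subring.closure_le.2 ?_ (h.mem_closure_of_mem_laurent j hf hj)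
    rintro a (ha | ha | ha)
    · exact hpT ha
    · rw [ha]; exact hyT
    · rw [Set.mem_singleton_iff.1 ha, hy']
      refine T.sub_mem (T.mul_mem (hpT (mon_mem_partialLaurent fun i hi => ?_))
        (le_saturation _ _ (vars_mem_laurent _))) hgT
      simp only [Set.mem_compl_iff, not_not, Set.mem_singleton_iff] at hi
      rw [hi, Pi.neg_apply, hshift, neg_zero]
  · rw [← h1.mutate_mutate j] at hk
    exact h2.laurent_mutate_le j hk

/-- An element that is a Laurent polynomial in a cluster and in two adjacent clusters is a Laurent
polynomial in the cluster obtained by composing the two mutations. -/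
lemma Nondegenerate.mem_laurent_mutate_mutate (h : s.Nondegenerate I) {j k : Fin N} (hjk : j ≠ k)
    {f : Ambient N M} (hf : f ∈ s.laurent S) (hk : f ∈ (s.mutate k).laurent S)
    (hj : f ∈ (s.mutate j).laurent S) : f ∈ ((s.mutate k).mutate j).laurent S := by
  by_cases hB : s.B j (Sum.inl k) = 0
  · exact h.mem_laurent_of_eq_zero hjk hB hk hj
  · have h1 := h.mutate k
    have hS := Set.subset_univ S
    refine (h1.mutate j).mem_laurent_of_univ j (h.mem_laurent_univ_of_ne_zero hjk hB
      (laurent_mono hS hf) (laurent_mono hS hk) (laurent_mono hS hj)) ?_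
    rw [← h1.mutate_mutate j] at hk
    exact (h1.mutate j).laurent_mutate_le j hk

/-! ### Elements that are Laurent polynomials in all neighbouring clusters -/

/-- The converse is the same statement with `μ_k s` as the starting seed, mutation being an
involution. -/
lemma Nondegenerate.mem_laurent_mutate_iff (h : s.Nondegenerate I) {k : Fin N}
    {f : Ambient N M} (hf : f ∈ s.laurent S) (hk : f ∈ (s.mutate k).laurent S) (j : Fin N) :
    f ∈ (s.mutate j).laurent S ↔ f ∈ ((s.mutate k).mutate j).laurent S := by
  by_cases hjk : j = k
  · subst hjk
    rw [h.mutate_mutate]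
    exact iff_of_true hk hf
  · refine ⟨h.mem_laurent_mutate_mutate hjk hf hk, fun hj => ?_⟩
    have := (h.mutate k).mem_laurent_mutate_mutate hjk hk (by rwa [h.mutate_mutate]) hj
    rwa [h.mutate_mutate] at this

/-- Laurent polynomials in a cluster and in all adjacent clusters. -/
def IsStarLaurent (S : Set (Fin M)) (s : Seed N M d) (f : Ambient N M) : Prop :=
  f ∈ s.laurent S ∧ ∀ k, f ∈ (s.mutate k).laurent S

lemma Nondegenerate.isStarLaurent_mutate (h : s.Nondegenerate I) {f : Ambient N M}
    (hf : s.IsStarLaurent S f) (k : Fin N) : (s.mutate k).IsStarLaurent S f :=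
  ⟨hf.2 k, fun j => (h.mem_laurent_mutate_iff hf.1 (hf.2 k) j).1 (hf.2 j)⟩

lemma Nondegenerate.isStarLaurent_of_mutationEquiv (h : s.Nondegenerate I) {f : Ambient N M}
    (hf : s.IsStarLaurent S f) (hst : s.MutationEquiv t) :
    t.Nondegenerate I ∧ t.IsStarLaurent S f := by
  induction hst with
  | refl => exact ⟨h, hf⟩
  | tail _ hadj ih =>
    obtain ⟨k, rfl⟩ := hadj
    exact ⟨ih.1.mutate k, ih.1.isStarLaurent_mutate ih.2 k⟩

end Seed

/-! ### Nerves and the upper cluster algebra -/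

open Seed

variable {N M : ℕ} {d : Fin N → ℕ} {I : Set (Fin M)} {s : Seed N M d} {S : Set (Fin M)}

lemma mutationEquiv_foldr (w : List (Fin N)) :
    s.MutationEquiv (w.foldr (fun k t => t.mutate k) s) := by
  induction w with
  | nil => exact .refl
  | cons k w ih => exact ih.tail ⟨k, rfl⟩

lemma nondegenerate_foldr (h : s.Nondegenerate I) (w : List (Fin N)) :
    (w.foldr (fun k t => t.mutate k) s).Nondegenerate I := by
  induction w with
  | nil => exact h
  | cons k w ih => exact ih.mutate k

lemma isStarLaurent_of_foldr (h : s.Nondegenerate I) {f : Ambient N M} (w : List (Fin N))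
    (hf : (w.foldr (fun k t => t.mutate k) s).IsStarLaurent S f) : s.IsStarLaurent S f := by
  induction w with
  | nil => exact hf
  | cons k w ih =>
    refine ih ?_
    have hw := nondegenerate_foldr h w
    have := (hw.mutate k).isStarLaurent_mutate hf k
    rwa [hw.mutate_mutate] at this

/-- Words encode paths from the root. For an edge traversed towards the root, the involution
property is used. -/
lemma seedAt_eq_mutate (h : s.Nondegenerate I) {k : Fin N} {v w : TreeVertex N}
    (hvw : EdgeLabel k v w) : seedAt s w = (seedAt s v).mutate k := by
  rcases hvw with hvw | hvw
  · simp [seedAt, hvw]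
  · have : seedAt s v = (seedAt s w).mutate k := by simp [seedAt, hvw]
    rw [this]
    exact ((nondegenerate_foldr h w.1).mutate_mutate k).symm

/-- Every label occurs on an edge of a nerve. -/
lemma IsNerve.exists_edgeLabel {H : (labeledTree N).Subgraph} (hH : IsNerve H) (k : Fin N) :
    ∃ v w : H.verts, H.Adj v w ∧ EdgeLabel k v.1 w.1 := by
  classical
  have hfin : H.verts.Finite := Set.finite_of_ncard_ne_zero (by rw [hH.card]; omega)
  have : Fintype H.verts := hfin.fintype
  have : Fintype H.coe.edgeSet := Fintype.ofFinite _
  -- A tree on `N + 1` vertices has `N` edges; their labels are distinct, hence exhaust all `N`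
  -- labels.
  have hcard : Fintype.card H.coe.edgeSet = Fintype.card (Fin N) := by
    have h1 := hH.isTree.card_edgeFinset
    rw [← Nat.card_eq_fintype_card (α := H.verts), Nat.card_coe_set_eq, hH.card,
      SimpleGraph.edgeFinset_card] at h1
    rw [Fintype.card_fin]
    omega
  have hlab : ∀ e : H.coe.edgeSet, ∃ k, ∃ v w : H.verts,
      e.1 = s(v, w) ∧ H.Adj v w ∧ EdgeLabel k v.1 w.1 := by
    rintro ⟨e, he⟩
    induction e with
    | h v w =>
      have hvw : H.Adj v w := he
      obtain ⟨k, hk⟩ := hvw.adj_sub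
      exact ⟨k, v, w, rfl, hvw, hk⟩
  choose lab v w he hadj hk using hlab
  have hinj : Function.Injective lab := by
    intro e e' hee
    have h1 := hH.labels (lab e) _ _ _ _ (hadj e) (hadj e') (hk e) (hee ▸ hk e')
    refine Subtype.ext (Sym2.map.injective Subtype.val_injective ?_)
    rw [he e, he e']
    exact h1
  obtain ⟨e, rfl⟩ := ((Fintype.bijective_iff_injective_and_card lab).2 ⟨hinj, hcard⟩).2 k
  exact ⟨v e, w e, hadj e, hk e⟩

lemma upperBound_eq_upperClusterAlgebra (h : s.Nondegenerate I) {H : (labeledTree N).Subgraph}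
    (hH : IsNerve H) :
    upperBound (groundRing N M S) s H = upperClusterAlgebra (groundRing N M S) s := by
  refine le_antisymm (fun f hf => ?_) fun f hf => ?_
  · have hmem : ∀ v : H.verts, f ∈ (seedAt s v.1).laurent S := fun v =>
      Algebra.mem_iInf.1 hf v
    -- Across each edge of the nerve `f` is Laurent at both ends, so `mem_laurent_mutate_iff`
    -- carries direction `j` from one end to the other; connectedness does the rest.
    have hiff : ∀ v w : H.verts, ∀ j,
        f ∈ ((seedAt s v.1).mutate j).laurent S ↔ f ∈ ((seedAt s w.1).mutate j).laurent S := by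
      intro v w j
      have hreach := hH.isTree.connected.preconnected v w
      rw [SimpleGraph.reachable_iff_reflTransGen] at hreach
      induction hreach with
      | refl => rfl
      | @tail a b _ hab ih =>
        refine ih.trans ?_
        obtain ⟨k, hk⟩ := (show H.Adj a b from hab).adj_sub
        have hab' := seedAt_eq_mutate h hk
        have := (nondegenerate_foldr h a.1.1).mem_laurent_mutate_iff (S := S) (k := k) (hmem a)
          (by have := hmem b; rwa [hab'] at this) j
        rw [hab']
        exact this
    obtain ⟨v⟩ := hH.isTree.connected.nonempty
    have hstar : (seedAt s v.1).IsStarLaurent S f := by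
      refine ⟨hmem v, fun k => ?_⟩
      -- On the edge labeled `k` the property in direction `k` is just membership at the other end
      -- `b`.
      obtain ⟨a, b, -, hk⟩ := hH.exists_edgeLabel k
      rw [hiff v a, ← seedAt_eq_mutate h hk]
      exact hmem b
    have hs := isStarLaurent_of_foldr h v.1.1 hstar
    exact Algebra.mem_iInf.2 fun t => (h.isStarLaurent_of_mutationEquiv hs t.2).2.1
  · exact Algebra.mem_iInf.2 fun v => Algebra.mem_iInf.1 hf ⟨_, mutationEquiv_foldr v.1.1⟩

end GenCluster

end

theorem mainTheorem4 {N M : ℕ} (d : Fin N → ℕ) (s : GenCluster.Seed N M d) (hs : s.IsSeed)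
    (hrank : (s.B.map (Int.cast : ℤ → ℚ)).rank = N)
    (hstring : ∀ i, d i ≠ 1 → ((s.stringMatrix i).map (Int.cast : ℤ → ℚ)).rank = d i - 1)
    (S : Set (Fin M)) :
    (∀ H₁ H₂ : (GenCluster.labeledTree N).Subgraph,
      GenCluster.IsNerve H₁ → GenCluster.IsNerve H₂ →
        GenCluster.upperBound (GenCluster.groundRing N M S) s H₁ =
          GenCluster.upperBound (GenCluster.groundRing N M S) s H₂) ∧
    (∀ H : (GenCluster.labeledTree N).Subgraph, GenCluster.IsNerve H →
      GenCluster.upperBound (GenCluster.groundRing N M S) s H =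
        GenCluster.Seed.upperClusterAlgebra (GenCluster.groundRing N M S) s) := by
  have h := hs.nondegenerate hrank hstring
  exact ⟨fun H₁ H₂ h₁ h₂ => (GenCluster.upperBound_eq_upperClusterAlgebra h h₁).trans
    (GenCluster.upperBound_eq_upperClusterAlgebra h h₂).symm,
    fun H hH => GenCluster.upperBound_eq_upperClusterAlgebra h hH⟩
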